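/- Let $H$ be a complex separable infinite-dimensional Hilbert space with a fixed orthonormal basis $(e_n)_{n\ge 1}$; operators on $H$ are identified with their infinite matrices in this basis. For a bounded sequence $\rho$ let $\operatorname{diag}\rho$ be the diagonal operator with diagonal $\rho$, and for $A\in B(H)$ let $E(A)$ be the diagonal operator with the same main diagonal as $A$. *Sequences.* $c_0^*$ (resp. $(\ell^1)^*$) is the cone of nonnegative nonincreasing sequences that converge to $0$ (resp. are summable). For $\xi,\eta\in c_0^*$: $\xi\preccurlyeq\eta$ means $\sum_{j\le n}\xi_j\le\sum_{j\le n}\eta_j$ for all $n$ and $\liminf_n\sum_{j\le n}(\eta_j-\xi_j)=0$. For $\xi,\eta\in(\ell^1)^*$: $\xi\prec_\infty\eta$ means $\sum_{j\ge n}\xi_j\le\sum_{j\ge n}\eta_j$ for all $n$, and $\xi\preccurlyeq_\infty\eta$ means in addition $\sum_{j\ge1}\xi_j=\sum_{j\ge1}\eta_j$. For $\xi\in(\ell^1)^*$ put $(\xi_{a_\infty})_n=\frac1n\sum_{j>n}\xi_j$. *Ideals.* For a compact operator $X$, $s(X)\in c_0^*$ is the sequence of eigenvalues of $(X^*X)^{1/2}$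 in nonincreasing order, repeated according to multiplicity, with infinitely many zeros added if $X$ has finite rank. $\mathscr L_1$ is the ideal of trace class operators. An ideal $I$ of compact operators has the characteristic set $\Sigma(I)=\{s(X): X\in I\}$; an ideal is recovered from its characteristic set $\Sigma$ as the two-sided ideal of $B(H)$ generated by $\{\operatorname{diag}\xi:\xi\in\Sigma\}$. The ideals $I_{a_\infty}$ and ${}_{a_\infty}I$ are those with the characteristic sets $$\Sigma(I_{a_\infty})=\{\xi\in c_0^*:\ \xi\le M\,\eta_{a_\infty}\text{ for some } M>0,\ \eta\in\Sigma(I\cap\mathscr L_1)\},\qquad \Sigma({}_{a_\infty}I)=\{\xi\in(\ell^1)^*:\ \xi_{a_\infty}\in\Sigma(I)\},$$ and the am-$\infty$ closure of $I$ is $I^{-\infty}={}_{a_\infty}(I_{a_\infty})$. *Matrices.* A matrix with nonnegative entries is column-stochastic if its row sums are at most $1$ and its column sums are equal to $1$. A matrix $Q$ is block orthostochastic if $Q_{ij}=(L_{ij})^2$ for a matrix $L$ that is the direct sum of finite (real) orthogonal matrices (the blocks corresponding to consecutive intervals of indices). $P\xi$ is the sequence $\big(\sum_j P_{ij}\xi_j\big)_i$.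 **Theorem 8.3.** Let $I\ne\{0\}$ be a two-sided ideal of $B(H)$ with $I\subseteq\mathscr L_1$ and let $\xi\in(\ell^1)^*$. Then the following conditions are equivalent. - (i) $\xi\in\Sigma(I^{-\infty})$. - (ii) $\xi\prec_\infty\eta$ for some $\eta\in\Sigma(I)$. - (ii$'$) $\xi\preccurlyeq_\infty\eta$ for some $\eta\in\Sigma(I)$. - (ii$''$) $\eta\preccurlyeq\xi$ for some $\eta\in\Sigma(I)$. - (iii) $P\xi\in\Sigma(I)$ for some column-stochastic matrix $P$. - (iii$'$) $Q\xi\in\Sigma(I)$ for some block orthostochastic matrix $Q$. - (iv) $E(V\operatorname{diag}\xi\,V^*)\in I$ for some isometry $V\in B(H)$. - (iv$'$) $E(U\operatorname{diag}\xi\,U^*)\in I$ for some matrix $U$ that is the direct sum of finite orthogonal matrices. -/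

import Mathlib

open scoped ENNReal InnerProductSpace

namespace OperatorIdeal

/-! Sequences are indexed by `ℕ` starting at `0`: the entry `ξ_{n+1}` of the sequence
`⟨ξ₁, ξ₂, …⟩` is `ξ n`. -/

/-! ### Monotone sequences and majorization -/

/-- The cone `c₀*` of nonnegative nonincreasing sequences converging to `0`. -/
def c0Star : Set (ℕ → ℝ) :=
  {ξ | (∀ n, 0 ≤ ξ n) ∧ Antitone ξ ∧ Filter.Tendsto ξ Filter.atTop (nhds 0)}

/-- The cone `(ℓ¹)*` of nonnegative nonincreasing summable sequences. -/
def l1Star : Set (ℕ → ℝ) :=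
  {ξ | (∀ n, 0 ≤ ξ n) ∧ Antitone ξ ∧ Summable ξ}

/-- `η` majorizes `ξ` (`ξ ≺ η`). -/
def Majorized (ξ η : ℕ → ℝ) : Prop :=
  ∀ n, ∑ j ∈ Finset.range n, ξ j ≤ ∑ j ∈ Finset.range n, η j

/-- `η` strongly majorizes `ξ` (`ξ ≼ η`): majorization together with
`liminf ∑_{j ≤ n} (η_j - ξ_j) = 0`. The lower limit is taken in the extended reals. -/
def StronglyMajorized (ξ η : ℕ → ℝ) : Prop :=
  Majorized ξ η ∧
    Filter.liminf (fun n : ℕ => ((∑ j ∈ Finset.range n, (η j - ξ j) : ℝ) : EReal))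
      Filter.atTop = 0

/-- `η` majorizes `ξ` at infinity (`ξ ≺_∞ η`), for sequences in `(ℓ¹)*`. -/
def MajorizedAtInfty (ξ η : ℕ → ℝ) : Prop :=
  ξ ∈ l1Star ∧ η ∈ l1Star ∧ ∀ n, ∑' j, ξ (n + j) ≤ ∑' j, η (n + j)

/-- `η` strongly majorizes `ξ` at infinity (`ξ ≼_∞ η`), for sequences in `(ℓ¹)*`. -/
def StronglyMajorizedAtInfty (ξ η : ℕ → ℝ) : Prop :=
  MajorizedAtInfty ξ η ∧ ∑' j, ξ j = ∑' j, η j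

/-- The arithmetic mean at infinity `(ξ_{a_∞})_n = (1/n) ∑_{j > n} ξ_j` (`n ≥ 1`) of a summable
sequence; with indices starting at `0`, the `n`-th entry is `(1/(n+1)) ∑_{j ≥ n+1} ξ j`. -/
noncomputable def amInfty (ξ : ℕ → ℝ) (n : ℕ) : ℝ :=
  (1 / ((n : ℝ) + 1)) * ∑' j, ξ (n + 1 + j)

/-! ### Stochastic matrices -/

/-- A matrix with nonnegative entries whose row sums and column sums are bounded by `1`. -/
def IsSubstochastic (P : Matrix ℕ ℕ ℝ) : Prop :=
  (∀ i j, 0 ≤ P i j) ∧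
  (∀ i, Summable (fun j => P i j) ∧ ∑' j, P i j ≤ 1) ∧
  (∀ j, Summable (fun i => P i j) ∧ ∑' i, P i j ≤ 1)

/-- A substochastic matrix whose column sums are all equal to `1`. -/
def IsColumnStochastic (P : Matrix ℕ ℕ ℝ) : Prop :=
  IsSubstochastic P ∧ ∀ j, ∑' i, P i j = 1

/-- The sequence `Pρ = ⟨∑_j P_{ij} ρ_j⟩_i`, for `P` substochastic and `ρ` bounded. -/
noncomputable def matApply (P : Matrix ℕ ℕ ℝ) (ρ : ℕ → ℝ) (i : ℕ) : ℝ :=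
  ∑' j, P i j * ρ j

/-- `L` is a direct sum of finite orthogonal matrices, the `k`-th summand corresponding to the
indices `n k ≤ i < n (k + 1)`, where `0 = n 0 < n 1 < n 2 < ⋯`. -/
def IsBlockOrthogonal (L : Matrix ℕ ℕ ℝ) : Prop :=
  ∃ n : ℕ → ℕ, n 0 = 0 ∧ StrictMono n ∧
    (∀ i j, L i j ≠ 0 →
      ∃ k, i ∈ Set.Ico (n k) (n (k + 1)) ∧ j ∈ Set.Ico (n k) (n (k + 1))) ∧
    ∀ k, (Matrix.of fun a b : Fin (n (k + 1) - n k) => L (n k + a) (n k + b)) ∈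
      Matrix.orthogonalGroup (Fin (n (k + 1) - n k)) ℝ

/-- The entrywise square of a direct sum of finite orthogonal matrices. -/
def IsBlockOrthostochastic (Q : Matrix ℕ ℕ ℝ) : Prop :=
  ∃ L : Matrix ℕ ℕ ℝ, IsBlockOrthogonal L ∧ ∀ i j, Q i j = (L i j) ^ 2

/-! ### Operators on a Hilbert space with a fixed orthonormal basis -/

open Classical in
/-- The operator `diag ρ` whose matrix in the orthonormal basis `e` is diagonal with main diagonal
`ρ`, for `ρ` bounded (the value for unbounded `ρ` is `0` and is never used). -/
noncomputable def diagOp {H : Type*} [NormedAddCommGroup H] [InnerProductSpace ℂ H]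
    (e : HilbertBasis ℕ ℂ H) (ρ : ℕ → ℂ) : H →L[ℂ] H :=
  if h : ∃ C : ℝ, 0 ≤ C ∧ ∀ n, ‖ρ n‖ ≤ C then
    (e.repr.symm.toContinuousLinearEquiv : lp (fun _ : ℕ => ℂ) 2 →L[ℂ] H) ∘L
      lp.mapCLM (𝕜 := ℂ) 2 (fun n => ρ n • ContinuousLinearMap.id ℂ ℂ) h.choose_spec.1
        (fun n => by simpa [norm_smul] using h.choose_spec.2 n) ∘L
      (e.repr.toContinuousLinearEquiv : H →L[ℂ] lp (fun _ : ℕ => ℂ) 2)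
  else 0

/-- For bounded `ρ`, the coordinates of `(diag ρ) x` are those of `x` multiplied by `ρ`. -/
theorem repr_diagOp {H : Type*} [NormedAddCommGroup H] [InnerProductSpace ℂ H]
    (e : HilbertBasis ℕ ℂ H) {ρ : ℕ → ℂ} {C : ℝ} (hρ : ∀ n, ‖ρ n‖ ≤ C) (x : H) (n : ℕ) :
    e.repr (diagOp e ρ x) n = ρ n * e.repr x n := by
  have h : ∃ C : ℝ, 0 ≤ C ∧ ∀ n, ‖ρ n‖ ≤ C := ⟨C, (norm_nonneg _).trans (hρ 0), hρ⟩
  simp [diagOp, dif_pos h]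

/-- The conditional expectation onto the diagonal operators: `E(A)` is the diagonal operator with
the same main diagonal as `A`. -/
noncomputable def expect {H : Type*} [NormedAddCommGroup H] [InnerProductSpace ℂ H]
    (e : HilbertBasis ℕ ℂ H) (A : H →L[ℂ] H) : H →L[ℂ] H :=
  diagOp e (fun n => ⟪e n, A (e n)⟫_ℂ)

/-- `A` is compact and `s` is its sequence `s(A)` of singular numbers: the eigenvalues of
`|A| = (A*A)^{1/2}` in nonincreasing order, repeated according to multiplicity, followed by zeros if
`A` has finite rank. That is, `s` decreases to `0`, and there is an orthonormal sequence of
eigenvectors of `|A|` for the eigenvalues `s n` such that `|A|` vanishes on its orthogonal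
complement. (If `A` has infinite rank, all `s n` are then positive; `H` is meant to be
infinite-dimensional.) -/
def IsSNumberSeq {H : Type*} [NormedAddCommGroup H] [InnerProductSpace ℂ H] [CompleteSpace H]
    (A : H →L[ℂ] H) (s : ℕ → ℝ) : Prop :=
  s ∈ c0Star ∧ ∃ f : ℕ → H, Orthonormal ℂ f ∧
    (∀ n, CFC.abs A (f n) = (s n : ℂ) • f n) ∧
    ∀ x, (∀ n, ⟪f n, x⟫_ℂ = 0) → CFC.abs A x = 0

/-! ### Operator ideals and characteristic sets -/

/-- The trace class operators: the compact operators with summable singular numbers. -/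
def traceClass (H : Type*) [NormedAddCommGroup H] [InnerProductSpace ℂ H] [CompleteSpace H] :
    Set (H →L[ℂ] H) :=
  {A | ∃ s, IsSNumberSeq A s ∧ Summable s}

/-- The characteristic set `Σ(I) = {s(X) | X ∈ I}` of an ideal `I` (or of any set of operators). -/
def charSet {H : Type*} [NormedAddCommGroup H] [InnerProductSpace ℂ H] [CompleteSpace H]
    (I : Set (H →L[ℂ] H)) : Set (ℕ → ℝ) :=
  {ξ | ∃ X ∈ I, IsSNumberSeq X ξ}

/-- The ideal with a given characteristic set `S`: the two-sided ideal generated by the operators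
`diag ξ` with `ξ ∈ S`. -/
noncomputable def idealOfCharSet {H : Type*} [NormedAddCommGroup H] [InnerProductSpace ℂ H]
    (e : HilbertBasis ℕ ℂ H) (S : Set (ℕ → ℝ)) : TwoSidedIdeal (H →L[ℂ] H) :=
  TwoSidedIdeal.span {A | ∃ ξ ∈ S, A = diagOp e (fun n => (ξ n : ℂ))}

/-- The arithmetic mean at infinity `I_{a_∞}` of an ideal `I`; its characteristic set consists of
the `ξ ∈ c₀*` with `ξ = O(η_{a_∞})` for some `η ∈ Σ(I ∩ 𝓛₁)`. -/
noncomputable def amInftyIdeal {H : Type*} [NormedAddCommGroup H] [InnerProductSpace ℂ H]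
    [CompleteSpace H] (e : HilbertBasis ℕ ℂ H) (I : TwoSidedIdeal (H →L[ℂ] H)) :
    TwoSidedIdeal (H →L[ℂ] H) :=
  idealOfCharSet e {ξ | ξ ∈ c0Star ∧ ∃ η ∈ charSet ((I : Set (H →L[ℂ] H)) ∩ traceClass H),
    ∃ M : ℝ, 0 < M ∧ ∀ n, ξ n ≤ M * amInfty η n}

/-- The pre-arithmetic mean at infinity `_{a_∞}I` of an ideal `I`; its characteristic set consists
of the `ξ ∈ (ℓ¹)*` with `ξ_{a_∞} ∈ Σ(I)`. -/
noncomputable def preAmInftyIdeal {H : Type*} [NormedAddCommGroup H] [InnerProductSpace ℂ H]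
    [CompleteSpace H] (e : HilbertBasis ℕ ℂ H) (I : TwoSidedIdeal (H →L[ℂ] H)) :
    TwoSidedIdeal (H →L[ℂ] H) :=
  idealOfCharSet e {ξ | ξ ∈ l1Star ∧ amInfty ξ ∈ charSet (I : Set (H →L[ℂ] H))}

/-- The am-∞ closure `I^{-∞} = _{a_∞}(I_{a_∞})` of an ideal `I`. -/
noncomputable def amInftyClosure {H : Type*} [NormedAddCommGroup H] [InnerProductSpace ℂ H]
    [CompleteSpace H] (e : HilbertBasis ℕ ℂ H) (I : TwoSidedIdeal (H →L[ℂ] H)) :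
    TwoSidedIdeal (H →L[ℂ] H) :=
  preAmInftyIdeal e (amInftyIdeal e I)

end OperatorIdeal

namespace OperatorIdeal

/-! ### Tails of summable sequences -/

/-! Every condition is compared with the existence of `η` in the characteristic set of `I` that
majorizes `ξ` at infinity.

To leave this condition, a greedy sequence `ζ` is built from `ξ` and `2η`: each entry is the minimum
of `2 * η n` and the part of the sum of `ξ` not yet used. Being at most `2η`, it stays in the
characteristic set. The tail inequality forces the unused part to vanish infinitely often, so `ζ` is
majorized by `ξ` with equal partial sums along a subsequence (`exists_block_majorized`). Hence the
totals agree and the lower limit of the differences is zero. On each block between two equalities,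
the finite Schur–Horn theorem (`exists_orthogonal_of_majorized`) gives an orthogonal matrix whose
squared entries send `ξ` to `ζ`; their direct sum yields the block orthostochastic matrix and the
isometry.

To return, the diagonal of `V diag ξ V*` is `Pξ` with `P` the squared moduli of the matrix of `V`,
which is column-stochastic (`expect_conj_diagOp`, `isColumnStochastic_of_isometry`). The singular
numbers of `diag(Pξ)` come from `ξ` by a further substochastic averaging that preserves the sum.
Averaging lowers the partial sums of a nonincreasing sequence, and with equal totals this is
majorization at infinity (`exists_majorizedAtInfty_of_diagOp_mem`).

For the am-∞ closure, the ideals are given by generators, so it must be shown that generation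
creates no singular sequences beyond the prescribed ones. Singular numbers are identified with
approximation numbers, whose behaviour under sums and products shows that a family of sequences
closed under sums, scaling and ampliation still bounds them (`exists_bound_of_mem_idealOfCharSet`).
Comparing arithmetic means at infinity then amounts to comparing tails, except for the full sum,
which a constant repairs. -/

theorem tsum_tail_eq {ξ : ℕ → ℝ} (h : Summable ξ) (n : ℕ) :
    ∑' j, ξ (n + j) = ∑' j, ξ j - ∑ j ∈ Finset.range n, ξ j := by
  rw [← h.sum_add_tsum_nat_add n]
  simp [add_comm]

theorem summable_tail {ξ : ℕ → ℝ} (h : Summable ξ) (n : ℕ) : Summable fun j => ξ (n + j) := by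
  simpa [add_comm] using (summable_nat_add_iff n).2 h

theorem l1Star_subset_c0Star : l1Star ⊆ c0Star :=
  fun _ h => ⟨h.1, h.2.1, h.2.2.tendsto_atTop_zero⟩

theorem tail_nonneg {ξ : ℕ → ℝ} (h : ξ ∈ l1Star) (n : ℕ) : 0 ≤ ∑' j, ξ (n + j) :=
  tsum_nonneg fun _ => h.1 _

theorem tail_succ {ξ : ℕ → ℝ} (h : Summable ξ) (n : ℕ) :
    ∑' j, ξ (n + j) = ξ n + ∑' j, ξ (n + 1 + j) := by
  rw [tsum_tail_eq h, tsum_tail_eq h, Finset.sum_range_succ]; ring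

theorem tail_antitone {ξ : ℕ → ℝ} (h : ξ ∈ l1Star) : Antitone fun n => ∑' j, ξ (n + j) :=
  antitone_nat_of_succ_le fun n => by
    have := tail_succ h.2.2 n
    have := h.1 n
    linarith

/-! ### A sequence squeezed between majorization and domination -/

/-- The excess of the partial sums of `ξ` over those of `squeeze ξ η`. -/
noncomputable def squeezeGap (ξ η : ℕ → ℝ) : ℕ → ℝ
  | 0 => 0
  | n + 1 => max 0 (squeezeGap ξ η n + ξ n - η n)

/-- The sequence that is as large as possible subject to being dominated by `η` and having partial
sums bounded by those of `ξ`. -/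
noncomputable def squeeze (ξ η : ℕ → ℝ) (n : ℕ) : ℝ :=
  min (η n) (squeezeGap ξ η n + ξ n)

theorem squeezeGap_nonneg (ξ η : ℕ → ℝ) : ∀ n, 0 ≤ squeezeGap ξ η n
  | 0 => le_rfl
  | _ + 1 => le_max_left _ _

theorem squeezeGap_succ (ξ η : ℕ → ℝ) (n : ℕ) :
    squeezeGap ξ η (n + 1) = squeezeGap ξ η n + ξ n - squeeze ξ η n := by
  rw [squeezeGap, squeeze]
  rcases le_total (η n) (squeezeGap ξ η n + ξ n) with h | h
  · rw [min_eq_left h, max_eq_right (by linarith)]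
  · rw [min_eq_right h, max_eq_left (by linarith)]; ring

theorem sum_squeeze (ξ η : ℕ → ℝ) (n : ℕ) :
    ∑ j ∈ Finset.range n, squeeze ξ η j = ∑ j ∈ Finset.range n, ξ j - squeezeGap ξ η n := by
  induction n with
  | zero => simp [squeezeGap]
  | succ n ih => rw [Finset.sum_range_succ, Finset.sum_range_succ, ih, squeezeGap_succ]; ring

theorem squeeze_nonneg {ξ η : ℕ → ℝ} (hξ : ∀ n, 0 ≤ ξ n) (hη : ∀ n, 0 ≤ η n) (n : ℕ) :
    0 ≤ squeeze ξ η n :=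
  le_min (hη n) (add_nonneg (squeezeGap_nonneg _ _ _) (hξ n))

/-- When `η n` is the minimum, monotonicity of `η` suffices. Otherwise the gap resets to zero, so
the next entry is at most `ξ (n + 1)`, and monotonicity of `ξ` takes over. -/
theorem squeeze_antitone {ξ η : ℕ → ℝ} (hξ : Antitone ξ) (hη : Antitone η) :
    Antitone (squeeze ξ η) := by
  refine antitone_nat_of_succ_le fun n => ?_
  rcases le_total (η n) (squeezeGap ξ η n + ξ n) with h | h
  · rw [squeeze, squeeze, min_eq_left h]
    exact (min_le_left _ _).trans (hη n.le_succ)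
  · have hg : squeezeGap ξ η (n + 1) = 0 := by
      rw [squeezeGap, max_eq_left (by linarith)]
    rw [squeeze, squeeze, min_eq_right h, hg]
    have := hξ n.le_succ
    have := squeezeGap_nonneg ξ η n
    exact (min_le_right _ _).trans (by simp only [Nat.succ_eq_add_one] at *; linarith)

/-- If the gap stayed positive after `M`, it would telescope to partial sums of `ξ - 2η` from `M`
on. In the limit the tail of `ξ` would be at least twice that of `η`, hence at least twice itself,
hence zero. Then `ξ M = 0` and the gap at `M + 1` could not be positive. The factor 2 is what makes
the tail vanish. -/
theorem exists_squeezeGap_eq_zero {ξ η : ℕ → ℝ} (h : MajorizedAtInfty ξ η) {M : ℕ}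
    (hM : squeezeGap ξ (fun n => 2 * η n) M = 0) :
    ∃ n, M < n ∧ squeezeGap ξ (fun n => 2 * η n) n = 0 := by
  obtain ⟨hξ, hη, hle⟩ := h
  set g := squeezeGap ξ (fun n => 2 * η n) with hg
  by_contra! hne
  have hpos : ∀ n, M < n → 0 < g n := fun n hn =>
    lt_of_le_of_ne (squeezeGap_nonneg _ _ n) (hne n hn).symm
  have hstep : ∀ n, M ≤ n → g (n + 1) = g n + ξ n - 2 * η n := by
    intro n hn
    have h1 := hpos (n + 1) (by omega)
    have h2 : g (n + 1) = max 0 (g n + ξ n - 2 * η n) := rfl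
    rw [h2] at h1 ⊢
    rcases le_total 0 (g n + ξ n - 2 * η n) with h3 | h3
    · exact max_eq_right h3
    · rw [max_eq_left h3] at h1; exact absurd h1 (lt_irrefl _)
  have hsum : ∀ k, g (M + k) = ∑ j ∈ Finset.range k, (ξ (M + j) - 2 * η (M + j)) := by
    intro k
    induction k with
    | zero => simpa using hM
    | succ k ih =>
      rw [Finset.sum_range_succ, ← ih, ← add_assoc, hstep _ (by omega)]; ring
  have hsξ := summable_tail hξ.2.2 M
  have hsη := summable_tail hη.2.2 M
  have hlim := (hsξ.sub (hsη.mul_left 2)).hasSum.tendsto_sum_nat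
  have h0 : 0 ≤ ∑' j, (ξ (M + j) - 2 * η (M + j)) :=
    ge_of_tendsto' hlim fun k => by
      rw [← hsum k]; exact squeezeGap_nonneg _ _ _
  rw [hsξ.tsum_sub (hsη.mul_left 2), tsum_mul_left] at h0
  have h1 := hle M
  have h2 : ξ M ≤ ∑' j, ξ (M + j) := by
    rw [tail_succ hξ.2.2]; linarith [tail_nonneg hξ (M + 1)]
  have h3 := hpos (M + 1) (by omega)
  rw [hstep M le_rfl, hM] at h3
  have := hη.1 M
  linarith [hξ.1 M]

/-- If `ξ ≺_∞ η`, then some `ζ ≤ 2 η` is majorized by `ξ` with infinitely many equalities. -/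
theorem exists_block_majorized {ξ η : ℕ → ℝ} (h : MajorizedAtInfty ξ η) :
    ∃ ζ ∈ l1Star, (∀ n, ζ n ≤ 2 * η n) ∧ Majorized ζ ξ ∧ ∃ m : ℕ → ℕ, m 0 = 0 ∧ StrictMono m ∧
      ∀ k, ∑ j ∈ Finset.range (m k), ζ j = ∑ j ∈ Finset.range (m k), ξ j := by
  set η' : ℕ → ℝ := fun n => 2 * η n with hη'
  have hη0 : ∀ n, 0 ≤ η' n := fun n => by have := h.2.1.1 n; simp only [hη']; linarith
  have hle : ∀ n, squeeze ξ η' n ≤ 2 * η n := fun n => min_le_left _ _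
  choose! nx hnx using fun M => exists_squeezeGap_eq_zero h (M := M)
  let m : ℕ → ℕ := fun k => nx^[k] 0
  have hm : ∀ k, squeezeGap ξ η' (m k) = 0 := by
    intro k
    induction k with
    | zero => rfl
    | succ k ih => simp only [m, Function.iterate_succ_apply']; exact (hnx _ ih).2
  refine ⟨squeeze ξ η', ⟨squeeze_nonneg h.1.1 hη0, squeeze_antitone h.1.2.1 ?_, ?_⟩, hle, ?_,
    m, rfl, strictMono_nat_of_lt_succ fun k => ?_, fun k => ?_⟩
  · intro a b hab
    have := h.2.1.2.1 hab
    simp only [hη']; linarith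
  · exact Summable.of_nonneg_of_le (squeeze_nonneg h.1.1 hη0) hle (h.2.1.2.2.mul_left 2)
  · intro n
    rw [sum_squeeze]
    linarith [squeezeGap_nonneg ξ η' n]
  · simp only [m, Function.iterate_succ_apply']; exact (hnx _ (hm k)).1
  · rw [sum_squeeze, hm, sub_zero]

/-! ### Relations between the notions of majorization -/

theorem tsum_eq_of_frequently {ξ ζ : ℕ → ℝ} (hξ : Summable ξ) (hζ : Summable ζ) {m : ℕ → ℕ}
    (hm : StrictMono m)
    (h : ∀ k, ∑ j ∈ Finset.range (m k), ζ j = ∑ j ∈ Finset.range (m k), ξ j) :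
    ∑' j, ζ j = ∑' j, ξ j := by
  refine tendsto_nhds_unique (hζ.hasSum.tendsto_sum_nat.comp hm.tendsto_atTop) ?_
  simp only [Function.comp_def, h]
  exact hξ.hasSum.tendsto_sum_nat.comp hm.tendsto_atTop

/-- A tail is the total minus a partial sum, so with equal totals the inequality reverses. -/
theorem majorizedAtInfty_of_majorized {ξ η : ℕ → ℝ} (hξ : ξ ∈ l1Star) (hη : η ∈ l1Star)
    (h : Majorized η ξ) (hs : ∑' j, ξ j = ∑' j, η j) : MajorizedAtInfty ξ η := by
  refine ⟨hξ, hη, fun n => ?_⟩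
  rw [tsum_tail_eq hξ.2.2, tsum_tail_eq hη.2.2]
  linarith [h n]

/-- The differences of partial sums are nonnegative and vanish infinitely often. -/
theorem stronglyMajorized_of_frequently {ξ ζ : ℕ → ℝ} (h : Majorized ζ ξ) {m : ℕ → ℕ}
    (hm : StrictMono m)
    (he : ∀ k, ∑ j ∈ Finset.range (m k), ζ j = ∑ j ∈ Finset.range (m k), ξ j) :
    StronglyMajorized ζ ξ := by
  refine ⟨h, le_antisymm ?_ ?_⟩
  · refine Filter.liminf_le_of_frequently_le' ?_
    refine Filter.Frequently.of_forall (f := Filter.atTop) (p := fun k : ℕ => _) (fun k => ?_)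
      |> fun H => hm.tendsto_atTop.frequently H
    simp [Finset.sum_sub_distrib, he]
  · refine Filter.le_liminf_of_le (by isBoundedDefault) (Filter.Eventually.of_forall fun n => ?_)
    have := h n
    rw [Finset.sum_sub_distrib]
    exact_mod_cast sub_nonneg.2 this

/-- For summable sequences the lower limit is a limit, so its vanishing says that the totals agree.
-/
theorem majorizedAtInfty_of_stronglyMajorized {ξ η : ℕ → ℝ} (hξ : ξ ∈ l1Star) (hη : η ∈ l1Star)
    (h : StronglyMajorized η ξ) : MajorizedAtInfty ξ η := by
  refine majorizedAtInfty_of_majorized hξ hη h.1 ?_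
  have h1 : Filter.Tendsto (fun n : ℕ => ((∑ j ∈ Finset.range n, (ξ j - η j) : ℝ) : EReal))
      Filter.atTop (nhds ((∑' j, (ξ j - η j) : ℝ) : EReal)) :=
    (continuous_coe_real_ereal.tendsto _).comp (hξ.2.2.sub hη.2.2).hasSum.tendsto_sum_nat
  have h2 := h1.liminf_eq.symm.trans h.2
  have h3 : ∑' j, (ξ j - η j) = 0 := by exact_mod_cast h2
  rw [hξ.2.2.tsum_sub hη.2.2] at h3
  linarith

/-! ### The finite Schur–Horn theorem -/

/-- The sequence `b` with its entries `b k` and `b (k + 1)` replaced by `b k + b (k + 1) - t`. -/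
def mergeAt (b : ℕ → ℝ) (k : ℕ) (t : ℝ) (i : ℕ) : ℝ :=
  if i < k then b i else if i = k then b k + b (k + 1) - t else b (i + 1)

theorem sum_range_mergeAt_of_le (b : ℕ → ℝ) {k m : ℕ} (t : ℝ) (h : m ≤ k) :
    ∑ i ∈ Finset.range m, mergeAt b k t i = ∑ i ∈ Finset.range m, b i :=
  Finset.sum_congr rfl fun i hi => by
    rw [mergeAt, if_pos ((Finset.mem_range.1 hi).trans_le h)]

theorem sum_range_mergeAt_of_lt (b : ℕ → ℝ) {k m : ℕ} (t : ℝ) (h : k < m) :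
    ∑ i ∈ Finset.range m, mergeAt b k t i = ∑ i ∈ Finset.range (m + 1), b i - t := by
  induction m, h using Nat.le_induction with
  | base =>
    rw [Finset.sum_range_succ, sum_range_mergeAt_of_le b t le_rfl, Finset.sum_range_succ,
      Finset.sum_range_succ, mergeAt, if_neg (lt_irrefl k), if_pos rfl]
    ring
  | succ m hm ih =>
    rw [Finset.sum_range_succ, ih, Finset.sum_range_succ _ (m + 1), mergeAt, if_neg (by omega),
      if_neg (by omega)]
    ring

theorem mergeAt_antitone {b : ℕ → ℝ} (hb : Antitone b) {k : ℕ} {t : ℝ} (h1 : t ≤ b k)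
    (h2 : b (k + 1) ≤ t) : Antitone (mergeAt b k t) := by
  refine antitone_nat_of_succ_le fun i => ?_
  unfold mergeAt
  rcases lt_trichotomy (i + 1) k with h | h | h
  · rw [if_pos h, if_pos (by omega)]; exact hb (by omega)
  · rw [if_neg (by omega), if_pos h, if_pos (by omega)]
    have : b k ≤ b i := hb (by omega)
    linarith
  · rw [if_neg (by omega), if_neg (by omega), if_neg (by omega)]
    split_ifs with h3
    · subst h3
      have : b (i + 1 + 1) ≤ b (i + 1) := hb (by omega)
      linarith
    · exact hb (by omega)

/-- A crossing point of an antitone sequence. -/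
theorem exists_crossing {b : ℕ → ℝ} {t : ℝ} {N : ℕ} (h0 : t ≤ b 0) (hN : b (N + 1) ≤ t) :
    ∃ k ≤ N, t ≤ b k ∧ b (k + 1) ≤ t := by
  induction N with
  | zero => exact ⟨0, le_rfl, h0, hN⟩
  | succ N ih =>
    rcases le_total (b (N + 1)) t with h | h
    · obtain ⟨k, hk, h⟩ := ih h; exact ⟨k, by omega, h⟩
    · exact ⟨N + 1, le_rfl, h, hN⟩

theorem exists_rotation {x y t : ℝ} (h1 : t ≤ x) (h2 : y ≤ t) :
    ∃ c s : ℝ, c ^ 2 + s ^ 2 = 1 ∧ s ^ 2 * y + c ^ 2 * x = t := by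
  rcases eq_or_ne x y with rfl | hne
  · exact ⟨1, 0, by norm_num, by linarith⟩
  · have hxy : 0 < x - y := sub_pos.2 (lt_of_le_of_ne (h2.trans h1) hne.symm)
    refine ⟨√((t - y) / (x - y)), √((x - t) / (x - y)), ?_, ?_⟩ <;>
    · rw [Real.sq_sqrt (div_nonneg (by linarith) hxy.le),
        Real.sq_sqrt (div_nonneg (by linarith) hxy.le)]
      field_simp
      ring

/-- Induction on the size. The largest target `a 0` lies between two consecutive entries `b k` and
`b (k + 1)`. A plane rotation of these two coordinates produces `a 0` on the diagonal and leaves `b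
k + b (k + 1) - a 0` in the other place; the shortened sequence `mergeAt b k (a 0)` is nonincreasing
and majorizes the remaining targets. -/
theorem exists_orthogonal_of_majorized (N : ℕ) : ∀ a b : ℕ → ℝ, Antitone a → Antitone b →
    (∀ m ≤ N, ∑ i ∈ Finset.range m, a i ≤ ∑ i ∈ Finset.range m, b i) →
    ∑ i ∈ Finset.range N, a i = ∑ i ∈ Finset.range N, b i →
    ∃ L ∈ Matrix.orthogonalGroup (Fin N) ℝ, ∀ i : Fin N, ∑ j : Fin N, L i j ^ 2 * b j = a i := by
  induction N with
  | zero => exact fun a b _ _ _ _ => ⟨1, one_mem _, fun i => i.elim0⟩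
  | succ N ih =>
    intro a b ha hb hle heq
    -- Size one is separate because the crossing needs two consecutive entries of `b`.
    rcases Nat.eq_zero_or_pos N with rfl | hN
    · refine ⟨1, one_mem _, fun i => ?_⟩
      have h0 : b 0 = a 0 := by simpa using heq.symm
      obtain rfl : i = 0 := Fin.ext (by omega)
      simp [h0]
    obtain ⟨M, rfl⟩ : ∃ M, N = M + 1 := ⟨N - 1, by omega⟩
    have h0 : a 0 ≤ b 0 := by simpa using hle 1 (by omega)
    have hlast : b (M + 1) ≤ a 0 := by
      have h1 := hle (M + 1) (by omega)
      rw [Finset.sum_range_succ, Finset.sum_range_succ _ (M + 1)] at heq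
      have : a (M + 1) ≤ a 0 := ha (by omega)
      linarith
    obtain ⟨k, hkM, hk1, hk2⟩ := exists_crossing h0 hlast
    obtain ⟨c, s, hcs, ht⟩ := exists_rotation hk1 hk2
    have hsum : ∀ m, ∑ i ∈ Finset.range m, a (i + 1) = ∑ i ∈ Finset.range (m + 1), a i - a 0 :=
      fun m => by rw [Finset.sum_range_succ']; ring
    obtain ⟨L, hL, hLa⟩ := ih (fun i => a (i + 1)) (mergeAt b k (a 0))
      (fun i j hij => ha (by omega)) (mergeAt_antitone hb hk1 hk2)
      (fun m hm => by
        -- Before the merged entry the comparison is termwise, as every target is at most `a 0 ≤ b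
        -- k`; past it, both partial sums are the old ones less `a 0`.
        rcases le_or_gt m k with hmk | hmk
        · rw [sum_range_mergeAt_of_le b _ hmk]
          refine Finset.sum_le_sum fun i hi => ?_
          have hi := Finset.mem_range.1 hi
          exact (ha (by omega : 0 ≤ i + 1)).trans (hk1.trans (hb (by omega)))
        · rw [sum_range_mergeAt_of_lt b _ hmk, hsum]
          linarith [hle (m + 1) (by omega)])
      (by rw [sum_range_mergeAt_of_lt b _ (by omega), hsum, heq])
    let κ : Fin (M + 1) := ⟨k, by omega⟩
    let p : Fin (M + 2) := κ.succ
    -- `R` is `1 ⊕ L` followed by the rotation: the first row has `c` in column `k` and `s` in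
    -- column `k + 1`, and column `κ` of `L` is split into column `k` with factor `-s` and column `p
    -- = k + 1` with factor `c`.
    let w : Fin (M + 1) → ℝ := fun j => if j = κ then -s else 1
    let R : Matrix (Fin (M + 2)) (Fin (M + 2)) ℝ := fun i =>
      Fin.cases (p.insertNth (α := fun _ => ℝ) s (fun j => if j = κ then c else 0))
        (fun i' => p.insertNth (α := fun _ => ℝ) (L i' κ * c) (fun j => L i' j * w j)) i
    have hbs : ∀ j : Fin (M + 1), b (p.succAbove j) = if (j : ℕ) ≤ k then b j else b (j + 1) := by
      intro j
      by_cases h : (j : ℕ) ≤ k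
      · rw [if_pos h, Fin.succAbove_of_castSucc_lt _ _ (by
          rw [Fin.lt_def]; simp only [p, κ, Fin.val_castSucc, Fin.succ_mk]; omega)]
        rfl
      · rw [if_neg h, Fin.succAbove_of_le_castSucc _ _ (by
          rw [Fin.le_def]; simp only [p, κ, Fin.val_castSucc, Fin.succ_mk]; omega)]
        rfl
    have hp : b p = b (k + 1) := rfl
    have hLL : ∀ i i', ∑ j, L i j * L i' j = if i = i' then 1 else 0 := by
      intro i i'
      have := congrFun (congrFun (Matrix.mem_orthogonalGroup_iff _ _ |>.1 hL) i) i'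
      simpa [Matrix.mul_apply, Matrix.one_apply] using this
    -- Because `s ^ 2 = 1 - c ^ 2`, the weights lose the share `c ^ 2` at `κ`, which is the share
    -- carried by the inserted column `p`.
    have hdiff : ∀ f : Fin (M + 1) → ℝ, ∑ j, f j * w j ^ 2 = ∑ j, f j - f κ * c ^ 2 := by
      intro f
      rw [← Finset.add_sum_erase _ _ (Finset.mem_univ κ),
        ← Finset.add_sum_erase _ f (Finset.mem_univ κ)]
      have : ∑ j ∈ Finset.univ.erase κ, f j * w j ^ 2 = ∑ j ∈ Finset.univ.erase κ, f j :=
        Finset.sum_congr rfl fun j hj => by simp [w, Finset.ne_of_mem_erase hj]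
      rw [this]
      simp only [w, if_true]
      linear_combination f κ * hcs
    refine ⟨R, ?_, ?_⟩
    · rw [Matrix.mem_orthogonalGroup_iff]
      have h00 : ∀ i', ∑ j, R 0 j * R (Fin.succ i') j = 0 := by
        intro i'
        rw [Fin.sum_univ_succAbove _ p]
        simp only [R, Fin.cases_zero, Fin.cases_succ, Fin.insertNth_apply_same,
          Fin.insertNth_apply_succAbove, ite_mul, zero_mul, Finset.sum_ite_eq',
          Finset.mem_univ, if_true, w]
        ring
      ext i i'
      rw [Matrix.mul_apply]
      change ∑ j, R i j * R i' j = _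
      refine Fin.cases ?_ (fun i => ?_) i <;> refine Fin.cases ?_ (fun i' => ?_) i'
      · rw [Fin.sum_univ_succAbove _ p]
        simp only [R, Fin.cases_zero, Fin.insertNth_apply_same,
          Fin.insertNth_apply_succAbove, ite_mul, zero_mul, Finset.sum_ite_eq',
          Finset.mem_univ, if_true, Matrix.one_apply_eq]
        linear_combination hcs
      · rw [h00, Matrix.one_apply_ne (Fin.succ_ne_zero _).symm]
      · rw [Finset.sum_congr rfl fun j _ => mul_comm (R i.succ j) (R 0 j), h00,
          Matrix.one_apply_ne (Fin.succ_ne_zero _)]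
      · rw [Fin.sum_univ_succAbove _ p]
        simp only [R, Fin.cases_succ, Fin.insertNth_apply_same, Fin.insertNth_apply_succAbove]
        have h1 : ∀ j, L i j * w j * (L i' j * w j) = (L i j * L i' j) * w j ^ 2 := fun j => by ring
        simp only [h1, hdiff, hLL, Matrix.one_apply, Fin.succ_inj]
        ring
    · refine Fin.cases ?_ (fun i => ?_)
      · rw [Fin.sum_univ_succAbove _ p]
        simp only [R, Fin.cases_zero, Fin.insertNth_apply_same, Fin.insertNth_apply_succAbove,
          ite_pow, ite_mul, zero_mul, ne_eq, OfNat.ofNat_ne_zero, not_false_eq_true, zero_pow,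
          Finset.sum_ite_eq', Finset.mem_univ, if_true, hbs, hp]
        simpa [κ] using ht
      · rw [Fin.sum_univ_succAbove _ p]
        simp only [R, Fin.cases_succ, Fin.insertNth_apply_same, Fin.insertNth_apply_succAbove, hbs,
          hp]
        have hi := hLa i
        have h1 : ∀ j : Fin (M + 1), (L i j * w j) ^ 2 * (if (j : ℕ) ≤ k then b j else b (j + 1)) =
          (L i j ^ 2 * (if (j : ℕ) ≤ k then b j else b (j + 1))) * w j ^ 2 := fun j => by ring
        simp only [h1, hdiff]
        rw [Fin.val_succ, ← hi, ← Finset.add_sum_erase _ _ (Finset.mem_univ κ),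
          ← Finset.add_sum_erase _ (fun j : Fin (M + 1) => L i j ^ 2 * mergeAt b k (a 0) j)
            (Finset.mem_univ κ)]
        have h2 : ∑ j ∈ Finset.univ.erase κ,
            L i j ^ 2 * (if (j : ℕ) ≤ k then b j else b (j + 1)) =
            ∑ j ∈ Finset.univ.erase κ, L i j ^ 2 * mergeAt b k (a 0) j := by
          refine Finset.sum_congr rfl fun j hj => ?_
          have hjk : (j : ℕ) ≠ k := fun h => Finset.ne_of_mem_erase hj (Fin.ext h)
          rw [mergeAt]
          rcases lt_or_gt_of_ne hjk with h | h
          · rw [if_pos h.le, if_pos h]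
          · rw [if_neg (by omega), if_neg (by omega), if_neg hjk]
        rw [h2]
        simp only [mergeAt, κ, lt_irrefl, le_refl, if_true, if_false]
        rw [← ht]
        linear_combination (L i κ ^ 2 * b (k + 1)) * hcs

/-! ### Block orthogonal matrices -/

theorem exists_block {m : ℕ → ℕ} (h0 : m 0 = 0) (hm : StrictMono m) (i : ℕ) :
    ∃ k, i ∈ Set.Ico (m k) (m (k + 1)) := by
  have hex : ∃ k, i < m (k + 1) := ⟨i, (hm.le_apply (x := i)).trans_lt (hm i.lt_succ_self)⟩
  classical
  refine ⟨Nat.find hex, ?_, Nat.find_spec hex⟩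
  by_contra! h
  rcases Nat.eq_zero_or_pos (Nat.find hex) with h1 | h1
  · rw [h1, h0] at h; omega
  · refine Nat.find_min hex (m := Nat.find hex - 1) (by omega) ?_
    rwa [Nat.sub_add_cancel h1]

theorem block_unique {m : ℕ → ℕ} (hm : StrictMono m) {i k l : ℕ}
    (hk : i ∈ Set.Ico (m k) (m (k + 1))) (hl : i ∈ Set.Ico (m l) (m (l + 1))) : k = l := by
  have h1 := hm.lt_iff_lt.1 (hk.1.trans_lt hl.2)
  have h2 := hm.lt_iff_lt.1 (hl.1.trans_lt hk.2)
  omega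

theorem sum_Ico_eq_sum_fin (f : ℕ → ℝ) {a b : ℕ} (_ : a ≤ b) :
    ∑ i ∈ Finset.Ico a b, f i = ∑ i : Fin (b - a), f (a + i) := by
  rw [Finset.sum_Ico_eq_sum_range, Finset.sum_range]

/-- A sequence that is block majorized by `ξ` is `Qξ` for a block orthostochastic matrix `Q`. -/
theorem exists_blockOrthostochastic {ζ ξ : ℕ → ℝ} (hζ : Antitone ζ) (hξ : Antitone ξ)
    (h : Majorized ζ ξ) {m : ℕ → ℕ} (h0 : m 0 = 0) (hm : StrictMono m)
    (he : ∀ k, ∑ j ∈ Finset.range (m k), ζ j = ∑ j ∈ Finset.range (m k), ξ j) :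
    ∃ Q, IsBlockOrthostochastic Q ∧ matApply Q ξ = ζ := by
  have hsplit : ∀ (f : ℕ → ℝ) k l, ∑ i ∈ Finset.range l, f (m k + i) =
      ∑ i ∈ Finset.range (m k + l), f i - ∑ i ∈ Finset.range (m k), f i := fun f k l => by
    rw [Finset.sum_range_add]; ring
  -- Equal partial sums at both ends of a block turn global majorization into majorization with
  -- equal sums inside the block.
  have hex : ∀ k, ∃ L ∈ Matrix.orthogonalGroup (Fin (m (k + 1) - m k)) ℝ,
      ∀ i, ∑ j, L i j ^ 2 * ξ (m k + j) = ζ (m k + i) := fun k =>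
    exists_orthogonal_of_majorized _ (fun i => ζ (m k + i)) (fun i => ξ (m k + i))
      (fun i j hij => hζ (by omega)) (fun i j hij => hξ (by omega))
      (fun l _ => by rw [hsplit, hsplit, he]; linarith [h (m k + l)])
      (by
        have := hm k.lt_succ_self
        rw [hsplit, hsplit, he, Nat.add_sub_cancel' (hm k.lt_succ_self).le, he])
  choose Λ hΛ hΛζ using hex
  choose blk hblk using exists_block h0 hm
  -- Extending each block by zero to natural indices avoids transporting entries between `Fin` types
  -- of different sizes.
  let Λ' : ℕ → ℕ → ℕ → ℝ := fun k i j =>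
    if hij : i < m (k + 1) - m k ∧ j < m (k + 1) - m k then Λ k ⟨i, hij.1⟩ ⟨j, hij.2⟩ else 0
  have hΛ' : ∀ k (i j : Fin (m (k + 1) - m k)), Λ' k i j = Λ k i j := fun k i j => by
    simp [Λ']
  let L : Matrix ℕ ℕ ℝ := fun i j =>
    if blk i = blk j then Λ' (blk i) (i - m (blk i)) (j - m (blk i)) else 0
  have hL : ∀ k (i j : Fin (m (k + 1) - m k)), L (m k + i) (m k + j) = Λ k i j := by
    intro k i j
    have hb : ∀ i : Fin (m (k + 1) - m k), blk (m k + i) = k := fun i =>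
      block_unique hm (hblk _) ⟨by omega, by omega⟩
    simp only [L, hb, if_true, Nat.add_sub_cancel_left, hΛ']
  have hL0 : ∀ i j, blk i ≠ blk j → L i j = 0 := fun i j hij => if_neg hij
  refine ⟨fun i j => L i j ^ 2, ⟨L, ⟨m, h0, hm, fun i j hij => ?_, fun k => ?_⟩,
    fun _ _ => rfl⟩, ?_⟩
  · have : blk i = blk j := by by_contra hne; exact hij (hL0 i j hne)
    exact ⟨blk i, hblk i, this ▸ hblk j⟩
  · convert hΛ k using 1
    ext i j
    exact hL k i j
  · ext i
    obtain ⟨k, hk⟩ : ∃ k, blk i = k := ⟨_, rfl⟩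
    have hi := hblk i
    rw [hk] at hi
    change ∑' j, L i j ^ 2 * ξ j = ζ i
    rw [tsum_eq_sum (s := Finset.Ico (m k) (m (k + 1))), sum_Ico_eq_sum_fin _
      (hm k.lt_succ_self).le]
    · obtain ⟨i', rfl⟩ : ∃ i' : Fin (m (k + 1) - m k), i = m k + i' :=
        ⟨⟨i - m k, by have := hi.1; have := hi.2; omega⟩, by have := hi.1; simp; omega⟩
      simp only [hL, hΛζ]
    · intro j hj
      have : blk i ≠ blk j := fun hij => hj (by
        have := hblk j
        rw [← hij, hk] at this
        exact Finset.mem_Ico.2 this)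
      simp [hL0 i j this]

/-! ### Substochastic matrices and majorization -/

/-- The weight beyond the first `n` places is at most the room `∑ (1 - w j)` left in them. Moving it
there can only increase the sum, since `x` is nonincreasing. Extended nonnegative reals avoid
summability conditions. -/
theorem tsum_weights_mul_le {w x : ℕ → ℝ≥0∞} {n : ℕ} (hw1 : ∀ j, w j ≤ 1) (hw : ∑' j, w j ≤ n)
    (hx : Antitone x) : ∑' j, w j * x j ≤ ∑ j ∈ Finset.range n, x j := by
  have h1 : ∀ j, w j + (1 - w j) = 1 := fun j => add_tsub_cancel_of_le (hw1 j)
  have hT : ∑' j, w (j + n) ≤ ∑ j ∈ Finset.range n, (1 - w j) := by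
    have hfin : ∑ j ∈ Finset.range n, w j ≠ ∞ :=
      ENNReal.sum_ne_top.2 fun j _ => ne_top_of_le_ne_top ENNReal.one_ne_top (hw1 j)
    refine (ENNReal.add_le_add_iff_left hfin).1 ?_
    rw [Summable.sum_add_tsum_nat_add' (f := w) ENNReal.summable, ← Finset.sum_add_distrib]
    simpa [h1] using hw
  calc ∑' j, w j * x j
      = ∑ j ∈ Finset.range n, w j * x j + ∑' j, w (j + n) * x (j + n) :=
        (Summable.sum_add_tsum_nat_add' (f := fun j => w j * x j) ENNReal.summable).symm
    _ ≤ ∑ j ∈ Finset.range n, w j * x j + ∑' j, w (j + n) * x n := by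
        gcongr with j
        exact hx (Nat.le_add_left _ _)
    _ ≤ ∑ j ∈ Finset.range n, w j * x j + ∑ j ∈ Finset.range n, (1 - w j) * x j := by
        rw [ENNReal.tsum_mul_right]
        gcongr
        refine (mul_le_mul_left hT _).trans ?_
        rw [Finset.sum_mul]
        exact Finset.sum_le_sum fun j hj => mul_le_mul_right (hx (Finset.mem_range.1 hj).le) _
    _ = ∑ j ∈ Finset.range n, x j := by
        rw [← Finset.sum_add_distrib]
        exact Finset.sum_congr rfl fun j _ => by rw [← add_mul, h1, one_mul]

/-- Adding the first `n` rows of `P` gives weights at most 1 with total at most `n`. -/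
theorem sum_range_tsum_mul_le {P : ℕ → ℕ → ℝ≥0∞} {x : ℕ → ℝ≥0∞} (hr : ∀ i, ∑' j, P i j ≤ 1)
    (hc : ∀ j, ∑' i, P i j ≤ 1) (hx : Antitone x) (n : ℕ) :
    ∑ i ∈ Finset.range n, ∑' j, P i j * x j ≤ ∑ j ∈ Finset.range n, x j := by
  rw [← Summable.tsum_finsetSum fun _ _ => ENNReal.summable]
  simp only [← Finset.sum_mul]
  refine tsum_weights_mul_le (fun j => (ENNReal.sum_le_tsum _).trans (hc j)) ?_ hx
  rw [Summable.tsum_finsetSum fun _ _ => ENNReal.summable]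
  exact (Finset.sum_le_sum fun i _ => hr i).trans (by simp)

theorem majorizedAtInfty_of_tsum_mul {P : ℕ → ℕ → ℝ≥0∞} {ξ s : ℕ → ℝ} (hr : ∀ i, ∑' j, P i j ≤ 1)
    (hc : ∀ j, ∑' i, P i j ≤ 1) (hξ : ξ ∈ l1Star) (hs0 : ∀ n, 0 ≤ s n) (hs : Antitone s)
    (hP : ∀ i, ENNReal.ofReal (s i) = ∑' j, P i j * ENNReal.ofReal (ξ j))
    (ht : ∑' i, ENNReal.ofReal (s i) = ∑' j, ENNReal.ofReal (ξ j)) : MajorizedAtInfty ξ s := by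
  have hξt := ENNReal.ofReal_tsum_of_nonneg hξ.1 hξ.2.2
  have hsum : Summable s := by
    have := ENNReal.summable_toReal (f := fun i => ENNReal.ofReal (s i))
      (by rw [ht, ← hξt]; exact ENNReal.ofReal_ne_top)
    simpa [ENNReal.toReal_ofReal, hs0] using this
  refine majorizedAtInfty_of_majorized hξ ⟨hs0, hs, hsum⟩ (fun n => ?_) ?_
  · have h := sum_range_tsum_mul_le hr hc
      (x := fun j => ENNReal.ofReal (ξ j)) (fun i j hij => ENNReal.ofReal_le_ofReal (hξ.2.1 hij)) n
    simp only [← hP] at h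
    rw [← ENNReal.ofReal_sum_of_nonneg fun i _ => hs0 i,
      ← ENNReal.ofReal_sum_of_nonneg fun i _ => hξ.1 i] at h
    exact (ENNReal.ofReal_le_ofReal_iff (Finset.sum_nonneg fun i _ => hξ.1 i)).1 h
  · rw [← hξt, ← ENNReal.ofReal_tsum_of_nonneg hs0 hsum] at ht
    exact ((ENNReal.ofReal_eq_ofReal_iff (tsum_nonneg hs0) (tsum_nonneg hξ.1)).1 ht).symm

theorem ofReal_matApply {P : Matrix ℕ ℕ ℝ} (hP : IsSubstochastic P) {ξ : ℕ → ℝ} (hξ : ξ ∈ l1Star)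
    (i : ℕ) : ENNReal.ofReal (matApply P ξ i) =
      ∑' j, ENNReal.ofReal (P i j) * ENNReal.ofReal (ξ j) := by
  have hs : Summable fun j => P i j * ξ j := by
    refine Summable.of_nonneg_of_le (fun j => mul_nonneg (hP.1 i j) (hξ.1 j)) (fun j => ?_)
      ((hP.2.1 i).1.mul_right (ξ 0))
    exact mul_le_mul_of_nonneg_left (hξ.2.1 (Nat.zero_le j)) (hP.1 i j)
  rw [matApply, ENNReal.ofReal_tsum_of_nonneg (fun j => mul_nonneg (hP.1 i j) (hξ.1 j)) hs]
  exact tsum_congr fun j => ENNReal.ofReal_mul (hP.1 i j)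

theorem tsum_ofReal_row_le {P : Matrix ℕ ℕ ℝ} (hP : IsSubstochastic P) (i : ℕ) :
    ∑' j, ENNReal.ofReal (P i j) ≤ 1 := by
  rw [← ENNReal.ofReal_tsum_of_nonneg (hP.1 i) (hP.2.1 i).1]
  exact ENNReal.ofReal_le_one.2 (hP.2.1 i).2

theorem tsum_ofReal_column {P : Matrix ℕ ℕ ℝ} (hP : IsColumnStochastic P) (j : ℕ) :
    ∑' i, ENNReal.ofReal (P i j) = 1 := by
  rw [← ENNReal.ofReal_tsum_of_nonneg (fun i => hP.1.1 i j) (hP.1.2.2 j).1, hP.2,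
    ENNReal.ofReal_one]

theorem tsum_ofReal_matApply {P : Matrix ℕ ℕ ℝ} (hP : IsColumnStochastic P) {ξ : ℕ → ℝ}
    (hξ : ξ ∈ l1Star) :
    ∑' i, ENNReal.ofReal (matApply P ξ i) = ∑' j, ENNReal.ofReal (ξ j) := by
  simp only [ofReal_matApply hP.1 hξ]
  rw [ENNReal.tsum_comm]
  exact tsum_congr fun j => by rw [ENNReal.tsum_mul_right, tsum_ofReal_column hP, one_mul]

theorem matApply_nonneg {P : Matrix ℕ ℕ ℝ} (hP : IsSubstochastic P) {ξ : ℕ → ℝ} (hξ : ξ ∈ l1Star)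
    (i : ℕ) : 0 ≤ matApply P ξ i :=
  tsum_nonneg fun j => mul_nonneg (hP.1 i j) (hξ.1 j)

/-- If the nonincreasing sequence `s` arises from `Pξ`, with `P` column-stochastic, by a
substochastic matrix that preserves the sum, then `ξ ≺_∞ s`. -/
theorem majorizedAtInfty_of_columnStochastic {P : Matrix ℕ ℕ ℝ} (hP : IsColumnStochastic P)
    {R : ℕ → ℕ → ℝ≥0∞} (hr : ∀ i, ∑' j, R i j ≤ 1) (hc : ∀ j, ∑' i, R i j ≤ 1)
    {ξ s : ℕ → ℝ} (hξ : ξ ∈ l1Star) (hs0 : ∀ n, 0 ≤ s n) (hs : Antitone s)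
    (hR : ∀ i, ENNReal.ofReal (s i) = ∑' j, R i j * ENNReal.ofReal (matApply P ξ j))
    (ht : ∀ j, matApply P ξ j ≠ 0 → ∑' i, R i j = 1) : MajorizedAtInfty ξ s := by
  have hsum : ∑' i, ENNReal.ofReal (s i) = ∑' j, ENNReal.ofReal (ξ j) := by
    simp only [hR]
    rw [ENNReal.tsum_comm, ← tsum_ofReal_matApply hP hξ]
    refine tsum_congr fun j => ?_
    rw [ENNReal.tsum_mul_right]
    rcases eq_or_ne (matApply P ξ j) 0 with h | h
    · simp [h]
    · rw [ht j h, one_mul]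
  -- The product `RP` takes `ξ` to `s` and is again substochastic.
  refine majorizedAtInfty_of_tsum_mul
    (P := fun i k => ∑' j, R i j * ENNReal.ofReal (P j k)) (fun i => ?_) (fun k => ?_) hξ hs0 hs
    (fun i => ?_) hsum
  · rw [ENNReal.tsum_comm]
    refine le_trans (ENNReal.tsum_le_tsum fun j => ?_) (hr i)
    rw [ENNReal.tsum_mul_left]
    exact mul_le_of_le_one_right' (tsum_ofReal_row_le hP.1 j)
  · rw [ENNReal.tsum_comm, ← tsum_ofReal_column hP k]
    refine ENNReal.tsum_le_tsum fun j => ?_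
    rw [ENNReal.tsum_mul_right]
    exact mul_le_of_le_one_left' (hc j)
  · simp only [hR, ofReal_matApply hP.1 hξ, ← ENNReal.tsum_mul_left, ← ENNReal.tsum_mul_right]
    rw [ENNReal.tsum_comm]
    simp only [mul_assoc]

/-! ### Ampliations -/

/-- The ampliation `⟨ζ₁, ζ₁, ζ₂, ζ₂, …⟩`. -/
def ampliation (ζ : ℕ → ℝ) (n : ℕ) : ℝ := ζ (n / 2)

/-- The even and the odd values of `j` each run once through a tail of `ζ`; the parity of `n`
decides whether the two tails start at the same place. -/
theorem hasSum_ampliation {ζ : ℕ → ℝ} (h : Summable ζ) (n : ℕ) :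
    HasSum (fun j => ampliation ζ (n + j)) (∑' j, ζ (n / 2 + j) + ∑' j, ζ ((n + 1) / 2 + j)) := by
  refine HasSum.even_add_odd ?_ ?_
  · convert (summable_tail h (n / 2)).hasSum using 2 with k
    rw [ampliation]; congr 1; omega
  · convert (summable_tail h ((n + 1) / 2)).hasSum using 2 with k
    rw [ampliation]; congr 1; omega

theorem ampliation_mem_c0Star {ζ : ℕ → ℝ} (h : ζ ∈ c0Star) : ampliation ζ ∈ c0Star :=
  ⟨fun _ => h.1 _, fun _ _ hab => h.2.1 (Nat.div_le_div_right hab),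
    h.2.2.comp (Nat.tendsto_div_const_atTop two_ne_zero)⟩

theorem ampliation_mem_l1Star {ζ : ℕ → ℝ} (h : ζ ∈ l1Star) : ampliation ζ ∈ l1Star :=
  ⟨fun _ => h.1 _, fun _ _ hab => h.2.1 (Nat.div_le_div_right hab),
    by simpa using (hasSum_ampliation h.2.2 0).summable⟩

theorem MajorizedAtInfty.ampliation {ξ η : ℕ → ℝ} (h : MajorizedAtInfty ξ η) :
    MajorizedAtInfty (ampliation ξ) (ampliation η) := by
  refine ⟨ampliation_mem_l1Star h.1, ampliation_mem_l1Star h.2.1, fun n => ?_⟩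
  rw [(hasSum_ampliation h.1.2.2 n).tsum_eq, (hasSum_ampliation h.2.1.2.2 n).tsum_eq]
  exact add_le_add (h.2.2 _) (h.2.2 _)

theorem add_mem_l1Star {ξ η : ℕ → ℝ} (hξ : ξ ∈ l1Star) (hη : η ∈ l1Star) : ξ + η ∈ l1Star :=
  ⟨fun n => add_nonneg (hξ.1 n) (hη.1 n), hξ.2.1.add hη.2.1, hξ.2.2.add hη.2.2⟩

theorem smul_mem_l1Star {ξ : ℕ → ℝ} (hξ : ξ ∈ l1Star) {c : ℝ} (hc : 0 ≤ c) : c • ξ ∈ l1Star :=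
  ⟨fun n => mul_nonneg hc (hξ.1 n), fun _ _ h => mul_le_mul_of_nonneg_left (hξ.2.1 h) hc,
    hξ.2.2.mul_left c⟩

theorem add_mem_c0Star {ξ η : ℕ → ℝ} (hξ : ξ ∈ c0Star) (hη : η ∈ c0Star) : ξ + η ∈ c0Star :=
  ⟨fun n => add_nonneg (hξ.1 n) (hη.1 n), hξ.2.1.add hη.2.1, by
    have := hξ.2.2.add hη.2.2
    rwa [add_zero] at this⟩

theorem smul_mem_c0Star {ξ : ℕ → ℝ} (hξ : ξ ∈ c0Star) {c : ℝ} (hc : 0 ≤ c) : c • ξ ∈ c0Star :=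
  ⟨fun n => mul_nonneg hc (hξ.1 n), fun _ _ h => mul_le_mul_of_nonneg_left (hξ.2.1 h) hc, by
    have := hξ.2.2.const_mul c
    rwa [mul_zero] at this⟩

theorem MajorizedAtInfty.add {ξ η ξ' η' : ℕ → ℝ} (h : MajorizedAtInfty ξ η)
    (h' : MajorizedAtInfty ξ' η') : MajorizedAtInfty (ξ + ξ') (η + η') := by
  refine ⟨add_mem_l1Star h.1 h'.1, add_mem_l1Star h.2.1 h'.2.1, fun n => ?_⟩
  simp only [Pi.add_apply]
  rw [(summable_tail h.1.2.2 n).tsum_add (summable_tail h'.1.2.2 n),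
    (summable_tail h.2.1.2.2 n).tsum_add (summable_tail h'.2.1.2.2 n)]
  exact add_le_add (h.2.2 n) (h'.2.2 n)

theorem MajorizedAtInfty.smul {ξ η : ℕ → ℝ} (h : MajorizedAtInfty ξ η) {c : ℝ} (hc : 0 ≤ c) :
    MajorizedAtInfty (c • ξ) (c • η) := by
  refine ⟨smul_mem_l1Star h.1 hc, smul_mem_l1Star h.2.1 hc, fun n => ?_⟩
  simp only [Pi.smul_apply, smul_eq_mul, tsum_mul_left]
  exact mul_le_mul_of_nonneg_left (h.2.2 n) hc

theorem MajorizedAtInfty.of_le {ξ η ξ' : ℕ → ℝ} (h : MajorizedAtInfty ξ η) (h' : ξ' ∈ c0Star)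
    (hle : ∀ n, ξ' n ≤ ξ n) : MajorizedAtInfty ξ' η := by
  have hs : Summable ξ' := Summable.of_nonneg_of_le h'.1 hle h.1.2.2
  refine ⟨⟨h'.1, h'.2.1, hs⟩, h.2.1, fun n => le_trans ?_ (h.2.2 n)⟩
  exact (summable_tail hs n).tsum_le_tsum (fun _ => hle _) (summable_tail h.1.2.2 n)

/-! ### The arithmetic mean at infinity -/

theorem amInfty_mem_c0Star {η : ℕ → ℝ} (h : η ∈ l1Star) : amInfty η ∈ c0Star := by
  refine ⟨fun n => mul_nonneg (by positivity) (tail_nonneg h _), fun m n hmn => ?_, ?_⟩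
  · exact mul_le_mul
      (one_div_le_one_div_of_le (by positivity) (by exact_mod_cast Nat.succ_le_succ hmn))
      (tail_antitone h (Nat.succ_le_succ hmn)) (tail_nonneg h _) (by positivity)
  · have h1 : Filter.Tendsto (fun n : ℕ => 1 / ((n : ℝ) + 1) * ∑' j, η j) Filter.atTop
        (nhds (0 * ∑' j, η j)) := tendsto_one_div_add_atTop_nhds_zero_nat.mul_const _
    rw [zero_mul] at h1
    refine squeeze_zero (fun n => mul_nonneg (by positivity) (tail_nonneg h _)) (fun n => ?_) h1
    refine mul_le_mul_of_nonneg_left ?_ (by positivity)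
    simpa using tail_antitone h (Nat.zero_le (n + 1))

/-- The tail of the ampliation consists of two tails of `η`, each at least the one on the left; this
factor 2 pays for `n + 1 ≤ 2 * (n / 2 + 1)` in the denominators. -/
theorem ampliation_amInfty_le {η : ℕ → ℝ} (h : η ∈ l1Star) (n : ℕ) :
    ampliation (amInfty η) n ≤ amInfty (ampliation η) n := by
  rw [amInfty, (hasSum_ampliation h.2.2 (n + 1)).tsum_eq, ampliation, amInfty]
  have h1 : ∑' j, η (n / 2 + 1 + j) ≤ ∑' j, η ((n + 1) / 2 + j) :=
    tail_antitone h (by omega)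
  have h2 : (n + 1 + 1) / 2 = n / 2 + 1 := by omega
  rw [h2]
  have h3 := tail_nonneg h (n / 2 + 1)
  have h4 : ((n : ℝ) + 1) ≤ 2 * (((n / 2 : ℕ) : ℝ) + 1) := by
    have : n + 1 ≤ 2 * (n / 2 + 1) := by omega
    exact_mod_cast this
  calc 1 / (((n / 2 : ℕ) : ℝ) + 1) * ∑' j, η (n / 2 + 1 + j)
      ≤ 2 / ((n : ℝ) + 1) * ∑' j, η (n / 2 + 1 + j) := by
        refine mul_le_mul_of_nonneg_right ?_ h3
        rw [div_le_div_iff₀ (by positivity) (by positivity)]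
        linarith
    _ = 1 / ((n : ℝ) + 1) * (2 * ∑' j, η (n / 2 + 1 + j)) := by ring
    _ ≤ _ := mul_le_mul_of_nonneg_left (by linarith) (by positivity)

theorem amInfty_add {η η' : ℕ → ℝ} (h : Summable η) (h' : Summable η') :
    amInfty (η + η') = amInfty η + amInfty η' := by
  ext n
  simp only [amInfty, Pi.add_apply, (summable_tail h _).tsum_add (summable_tail h' _), mul_add]

theorem amInfty_smul (c : ℝ) (η : ℕ → ℝ) : amInfty (c • η) = c • amInfty η := by
  ext n
  simp only [amInfty, Pi.smul_apply, smul_eq_mul, tsum_mul_left]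
  ring

theorem amInfty_le_of_majorizedAtInfty {ξ η : ℕ → ℝ} (h : MajorizedAtInfty ξ η) (n : ℕ) :
    amInfty ξ n ≤ amInfty η n :=
  mul_le_mul_of_nonneg_left (h.2.2 _) (by positivity)

/-- If `ξ_{a_∞} ≤ η_{a_∞}`, then `ξ ≺_∞ c η` for a suitable constant `c`. -/
theorem majorizedAtInfty_of_amInfty_le {ξ η : ℕ → ℝ} (hξ : ξ ∈ l1Star) (hη : η ∈ l1Star)
    (h0 : 0 < η 0) (h : ∀ n, amInfty ξ n ≤ amInfty η n) :
    ∃ c : ℝ, 0 ≤ c ∧ MajorizedAtInfty ξ (c • η) := by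
  have htot : 0 < ∑' j, η j := hη.2.2.tsum_pos hη.1 0 h0
  -- The means only see tails starting at index 1 or later, for which the constant 1 suffices; the
  -- ratio of the totals serves the full sum.
  refine ⟨max 1 ((∑' j, ξ j) / ∑' j, η j), le_max_of_le_left zero_le_one, hξ,
    smul_mem_l1Star hη (le_max_of_le_left zero_le_one), fun n => ?_⟩
  simp only [Pi.smul_apply, smul_eq_mul, tsum_mul_left]
  rcases n with _ | n
  · simp only [zero_add]
    rw [← div_le_iff₀ htot]
    exact le_max_right _ _
  · have h1 := h n
    have h2 : ∑' j, ξ (n + 1 + j) ≤ ∑' j, η (n + 1 + j) :=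
      le_of_mul_le_mul_left h1 (by positivity)
    exact h2.trans (le_mul_of_one_le_left (tail_nonneg hη _) (le_max_left _ _))

/-! ### Diagonal operators, finite-rank approximation and singular numbers -/

section Operators

variable {H : Type*} [NormedAddCommGroup H] [InnerProductSpace ℂ H] (e : HilbertBasis ℕ ℂ H)

/-! ### Diagonal operators and isometries -/

theorem HilbertBasis_ext_inner {x y : H} (h : ∀ n, ⟪e n, x⟫_ℂ = ⟪e n, y⟫_ℂ) : x = y := by
  refine e.repr.injective (lp.ext (funext fun n => ?_))
  rw [e.repr_apply_apply, e.repr_apply_apply, h]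

theorem HilbertBasis_ext_clm {A B : H →L[ℂ] H} (h : ∀ n, A (e n) = B (e n)) : A = B := by
  refine ContinuousLinearMap.ext_on (s := Set.range e) ?_ (by rintro _ ⟨n, rfl⟩; exact h n)
  rw [Submodule.dense_iff_topologicalClosure_eq_top]
  exact e.dense_span

theorem inner_basis (i j : ℕ) : ⟪e i, e j⟫_ℂ = if i = j then 1 else 0 :=
  orthonormal_iff_ite.1 e.orthonormal i j

theorem inner_diagOp {ρ : ℕ → ℂ} {C : ℝ} (hρ : ∀ n, ‖ρ n‖ ≤ C) (x : H) (n : ℕ) :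
    ⟪e n, diagOp e ρ x⟫_ℂ = ρ n * ⟪e n, x⟫_ℂ := by
  rw [← e.repr_apply_apply, repr_diagOp e hρ, e.repr_apply_apply]

theorem diagOp_basis {ρ : ℕ → ℂ} {C : ℝ} (hρ : ∀ n, ‖ρ n‖ ≤ C) (n : ℕ) :
    diagOp e ρ (e n) = ρ n • e n := by
  refine HilbertBasis_ext_inner e fun m => ?_
  rw [inner_diagOp e hρ, inner_smul_right, inner_basis]
  split_ifs with h <;> simp [h]

theorem norm_diagOp_apply_le {ρ : ℕ → ℂ} {C : ℝ} (hρ : ∀ n, ‖ρ n‖ ≤ C) (x : H) :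
    ‖diagOp e ρ x‖ ≤ C * ‖x‖ := by
  have hC : 0 ≤ C := (norm_nonneg _).trans (hρ 0)
  rw [← e.repr.norm_map, ← e.repr.norm_map x]
  have : ‖e.repr (diagOp e ρ x)‖ ≤ ‖(C : ℂ) • e.repr x‖ :=
    lp.norm_mono two_ne_zero fun n => by
      rw [repr_diagOp e hρ, lp.coeFn_smul, Pi.smul_apply, norm_mul, norm_smul]
      refine mul_le_mul_of_nonneg_right ?_ (norm_nonneg _)
      simpa [abs_of_nonneg hC] using hρ n
  rwa [norm_smul, Complex.norm_real, Real.norm_of_nonneg hC] at this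

theorem diagOp_mul {ρ σ : ℕ → ℂ} {C D : ℝ} (hρ : ∀ n, ‖ρ n‖ ≤ C) (hσ : ∀ n, ‖σ n‖ ≤ D) :
    diagOp e ρ * diagOp e σ = diagOp e (ρ * σ) := by
  have hb : ∀ n, ‖(ρ * σ) n‖ ≤ C * D := fun n => by
    rw [Pi.mul_apply, norm_mul]
    exact mul_le_mul (hρ n) (hσ n) (norm_nonneg _) ((norm_nonneg _).trans (hρ n))
  refine HilbertBasis_ext_clm e fun n => ?_
  rw [mul_apply_eq_comp, diagOp_basis e hσ, map_smul, diagOp_basis e hρ,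
    diagOp_basis e hb, smul_smul, Pi.mul_apply, mul_comm]

theorem diagOp_add {ρ σ : ℕ → ℂ} {C D : ℝ} (hρ : ∀ n, ‖ρ n‖ ≤ C) (hσ : ∀ n, ‖σ n‖ ≤ D) :
    diagOp e ρ + diagOp e σ = diagOp e (ρ + σ) := by
  have hb : ∀ n, ‖(ρ + σ) n‖ ≤ C + D := fun n =>
    (norm_add_le _ _).trans (add_le_add (hρ n) (hσ n))
  refine HilbertBasis_ext_clm e fun n => ?_
  rw [add_apply, diagOp_basis e hσ, diagOp_basis e hρ,
    diagOp_basis e hb, ← add_smul, Pi.add_apply]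

/-- A nonnegative nonincreasing sequence is bounded by its first entry. -/
theorem norm_ofReal_le {η : ℕ → ℝ} (h : η ∈ c0Star) (n : ℕ) : ‖(η n : ℂ)‖ ≤ η 0 := by
  rw [Complex.norm_real, Real.norm_of_nonneg (h.1 n)]
  exact h.2.1 (Nat.zero_le n)

theorem isometry_inner {V : H →L[ℂ] H} (hV : Isometry V) (x y : H) :
    ⟪V x, V y⟫_ℂ = ⟪x, y⟫_ℂ :=
  LinearIsometry.inner_map_map
    (⟨V.toLinearMap, (AddMonoidHomClass.isometry_iff_norm V).1 hV⟩ : H →ₗᵢ[ℂ] H) x y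

theorem norm_isometry {V : H →L[ℂ] H} (hV : Isometry V) (x : H) : ‖V x‖ = ‖x‖ :=
  (AddMonoidHomClass.isometry_iff_norm V).1 hV x

/-- `X` is within distance `c` of the operators of rank at most `n`. -/
def ApproxWithin (X : H →L[ℂ] H) (n : ℕ) (c : ℝ) : Prop :=
  ∃ F : H →L[ℂ] H, LinearMap.rank (F : H →ₗ[ℂ] H) ≤ n ∧ ∀ x, ‖X x - F x‖ ≤ c * ‖x‖

theorem approxWithin_zero (n : ℕ) : ApproxWithin (0 : H →L[ℂ] H) n 0 :=
  ⟨0, by rw [ContinuousLinearMap.toLinearMap_zero, LinearMap.rank_zero]; exact bot_le, by simp⟩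

theorem ApproxWithin.add {X Y : H →L[ℂ] H} {n m k : ℕ} {c d : ℝ} (hX : ApproxWithin X n c)
    (hY : ApproxWithin Y m d) (hk : n + m ≤ k) : ApproxWithin (X + Y) k (c + d) := by
  obtain ⟨F, hF, hX⟩ := hX
  obtain ⟨G, hG, hY⟩ := hY
  refine ⟨F + G, ?_, fun x => ?_⟩
  · rw [ContinuousLinearMap.toLinearMap_add]
    refine (LinearMap.rank_add_le _ _).trans ((add_le_add hF hG).trans ?_)
    exact_mod_cast hk
  · rw [add_apply, add_apply, add_sub_add_comm, add_mul]
    exact (norm_add_le _ _).trans (add_le_add (hX x) (hY x))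

theorem ApproxWithin.mul_left {X : H →L[ℂ] H} {n : ℕ} {c : ℝ} (h : ApproxWithin X n c)
    (A : H →L[ℂ] H) : ApproxWithin (A * X) n (‖A‖ * c) := by
  obtain ⟨F, hF, hX⟩ := h
  refine ⟨A * F, (LinearMap.rank_comp_le_right (F : H →ₗ[ℂ] H) (A : H →ₗ[ℂ] H)).trans hF,
    fun x => ?_⟩
  rw [mul_apply_eq_comp, mul_apply_eq_comp, ← map_sub, mul_assoc]
  exact (A.le_opNorm _).trans (mul_le_mul_of_nonneg_left (hX x) (norm_nonneg _))

theorem ApproxWithin.mul_right {X : H →L[ℂ] H} {n : ℕ} {c : ℝ} (h : ApproxWithin X n c)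
    (hc : 0 ≤ c) (A : H →L[ℂ] H) : ApproxWithin (X * A) n (‖A‖ * c) := by
  obtain ⟨F, hF, hX⟩ := h
  refine ⟨F * A, (LinearMap.rank_comp_le_left (A : H →ₗ[ℂ] H) (F : H →ₗ[ℂ] H)).trans hF,
    fun x => ?_⟩
  rw [mul_apply_eq_comp, mul_apply_eq_comp, mul_comm ‖A‖, mul_assoc]
  exact (hX _).trans (mul_le_mul_of_nonneg_left (A.le_opNorm x) hc)

variable [CompleteSpace H]

theorem exists_isometry {v : ℕ → H} (hv : Orthonormal ℂ v) :
    ∃ V : H →L[ℂ] H, Isometry V ∧ ∀ n, V (e n) = v n := by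
  refine ⟨(hv.orthogonalFamily.linearIsometry.comp e.repr.toLinearIsometry).toContinuousLinearMap,
    (hv.orthogonalFamily.linearIsometry.comp e.repr.toLinearIsometry).isometry, fun n => ?_⟩
  change hv.orthogonalFamily.linearIsometry (e.repr (e n)) = v n
  rw [e.repr_self, OrthogonalFamily.linearIsometry_apply_single]
  simp

theorem adjoint_apply_isometry {V : H →L[ℂ] H} (hV : Isometry V) (x : H) :
    ContinuousLinearMap.adjoint V (V x) = x :=
  ext_inner_left ℂ fun y => by rw [ContinuousLinearMap.adjoint_inner_right, isometry_inner hV]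

theorem norm_adjoint_isometry_le {V : H →L[ℂ] H} (hV : Isometry V) (x : H) :
    ‖ContinuousLinearMap.adjoint V x‖ ≤ ‖x‖ := by
  have h1 : ‖V‖ ≤ 1 := V.opNorm_le_bound zero_le_one fun x => by rw [norm_isometry hV, one_mul]
  refine (ContinuousLinearMap.le_opNorm _ _).trans ?_
  rw [LinearIsometryEquiv.norm_map]
  exact mul_le_of_le_one_left (norm_nonneg _) h1

theorem diagOp_isPositive {η : ℕ → ℝ} {C : ℝ} (h0 : ∀ n, 0 ≤ η n) (hη : ∀ n, ‖(η n : ℂ)‖ ≤ C) :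
    0 ≤ diagOp e fun n => (η n : ℂ) := by
  have hsq : ∀ n, ‖((√(η n) : ℝ) : ℂ)‖ ≤ √C := fun n => by
    rw [Complex.norm_real, Real.norm_of_nonneg (Real.sqrt_nonneg _)]
    refine Real.sqrt_le_sqrt ?_
    simpa [abs_of_nonneg (h0 n)] using hη n
  have hadj : ContinuousLinearMap.adjoint (diagOp e fun n => ((√(η n) : ℝ) : ℂ)) =
      diagOp e fun n => ((√(η n) : ℝ) : ℂ) := by
    refine HilbertBasis_ext_clm e fun n => HilbertBasis_ext_inner e fun m => ?_
    rw [ContinuousLinearMap.adjoint_inner_right, diagOp_basis e hsq, diagOp_basis e hsq,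
      inner_smul_left, inner_smul_right, inner_basis]
    split_ifs with h <;> simp [h]
  have : (diagOp e fun n => (η n : ℂ)) = star (diagOp e fun n => ((√(η n) : ℝ) : ℂ)) *
      diagOp e fun n => ((√(η n) : ℝ) : ℂ) := by
    rw [ContinuousLinearMap.star_eq_adjoint, hadj, diagOp_mul e hsq hsq]
    congr 1
    ext n
    rw [Pi.mul_apply, ← Complex.ofReal_mul, Real.mul_self_sqrt (h0 n)]
  rw [this]
  exact star_mul_self_nonneg _

/-! ### Absolute values and singular numbers -/

theorem inner_abs_apply (X : H →L[ℂ] H) (x y : H) :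
    ⟪CFC.abs X x, y⟫_ℂ = ⟪x, CFC.abs X y⟫_ℂ := by
  have h := (CFC.abs_nonneg X).isSelfAdjoint.adjoint_eq
  rw [← ContinuousLinearMap.adjoint_inner_left, h]

theorem inner_abs_abs (X : H →L[ℂ] H) (x y : H) :
    ⟪CFC.abs X x, CFC.abs X y⟫_ℂ = ⟪X x, X y⟫_ℂ := by
  rw [inner_abs_apply, ← mul_apply_eq_comp, CFC.abs_mul_abs,
    ContinuousLinearMap.star_eq_adjoint, mul_apply_eq_comp,
    ContinuousLinearMap.adjoint_inner_right]

theorem norm_abs_apply (X : H →L[ℂ] H) (x : H) : ‖CFC.abs X x‖ = ‖X x‖ := by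
  have h := inner_abs_abs X x x
  rw [inner_self_eq_norm_sq_to_K, inner_self_eq_norm_sq_to_K] at h
  have h' : ‖CFC.abs X x‖ ^ 2 = ‖X x‖ ^ 2 := by exact_mod_cast h
  exact (sq_eq_sq₀ (norm_nonneg _) (norm_nonneg _)).1 h'

/-- The spectral decomposition of the absolute value of a compact operator. -/
theorem IsSNumberSeq.exists_isometry {X : H →L[ℂ] H} {s : ℕ → ℝ} (h : IsSNumberSeq X s) :
    ∃ V : H →L[ℂ] H, Isometry V ∧
      ∀ x, CFC.abs X x = V (diagOp e (fun n => (s n : ℂ)) (ContinuousLinearMap.adjoint V x)) := by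
  obtain ⟨hs, f, hf, hfs, hf0⟩ := h
  obtain ⟨V, hV, hVf⟩ := OperatorIdeal.exists_isometry e hf
  refine ⟨V, hV, fun x => ?_⟩
  have h1 : CFC.abs X * V = V * diagOp e fun n => (s n : ℂ) := HilbertBasis_ext_clm e fun n => by
    rw [mul_apply_eq_comp, mul_apply_eq_comp,
      diagOp_basis e (norm_ofReal_le hs), map_smul, hVf, hfs]
  -- `V V*` is the projection onto the closed span of the eigenvectors, and `|X|` vanishes on the
  -- complement.
  have h2 : CFC.abs X (x - V (ContinuousLinearMap.adjoint V x)) = 0 := hf0 _ fun n => by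
    rw [← hVf, ← ContinuousLinearMap.adjoint_inner_right, map_sub, adjoint_apply_isometry hV,
      sub_self, inner_zero_right]
  rw [map_sub, sub_eq_zero] at h2
  rw [h2, ← mul_apply_eq_comp, h1, mul_apply_eq_comp]

theorem isSNumberSeq_diagOp {η : ℕ → ℝ} (h : η ∈ c0Star) :
    IsSNumberSeq (diagOp e fun n => (η n : ℂ)) η := by
  have hb := norm_ofReal_le h
  have habs := CFC.abs_of_nonneg _ (diagOp_isPositive e h.1 hb)
  refine ⟨h, e, e.orthonormal, fun n => ?_, fun x hx => ?_⟩
  · rw [habs, diagOp_basis e hb]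
  · have : x = 0 := HilbertBasis_ext_inner e fun n => by rw [hx, inner_zero_right]
    rw [this, map_zero]

/-- Compress `X` to the span of the first `n` eigenvectors of `|X|`; on the rest only singular
numbers at most `s n` remain. -/
theorem IsSNumberSeq.approxWithin {X : H →L[ℂ] H} {s : ℕ → ℝ} (h : IsSNumberSeq X s)
    (e : HilbertBasis ℕ ℂ H) (n : ℕ) : ApproxWithin X n (s n) := by
  obtain ⟨V, hV, habs⟩ := h.exists_isometry e
  have hs := h.1
  let π : ℕ → ℂ := fun j => if j < n then 1 else 0
  have hπ : ∀ j, ‖π j‖ ≤ 1 := fun j => by by_cases hj : j < n <;> simp [π, hj]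
  let P := diagOp e π
  refine ⟨X * (V * (P * ContinuousLinearMap.adjoint V)), ?_, fun x => ?_⟩
  · have hP : LinearMap.rank (P : H →ₗ[ℂ] H) ≤ n := by
      classical
      have hle : LinearMap.range (P : H →ₗ[ℂ] H) ≤
          Submodule.span ℂ (((Finset.range n).image e : Finset H) : Set H) := by
        rintro _ ⟨x, rfl⟩
        have : P x = ∑ j ∈ Finset.range n, ⟪e j, x⟫_ℂ • e j := by
          refine HilbertBasis_ext_inner e fun m => ?_
          rw [inner_diagOp e hπ, inner_sum]
          simp only [inner_smul_right, inner_basis, mul_ite, mul_one, mul_zero,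
            Finset.sum_ite_eq, Finset.mem_range, π, ite_mul, one_mul, zero_mul]
        rw [ContinuousLinearMap.coe_coe, this]
        exact Submodule.sum_mem _ fun j hj => Submodule.smul_mem _ _
          (Submodule.subset_span (Finset.mem_coe.2 (Finset.mem_image_of_mem _ hj)))
      refine (Submodule.rank_mono hle).trans ((rank_span_finset_le _).trans ?_)
      exact_mod_cast Finset.card_image_le.trans (Finset.card_range n).le
    refine le_trans (LinearMap.rank_comp_le_right _ (X : H →ₗ[ℂ] H)) ?_
    refine le_trans (LinearMap.rank_comp_le_right _ (V : H →ₗ[ℂ] H)) ?_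
    exact (LinearMap.rank_comp_le_left _ (P : H →ₗ[ℂ] H)).trans hP
  · simp only [mul_apply_eq_comp]
    rw [← map_sub, ← norm_abs_apply, habs, norm_isometry hV, map_sub, adjoint_apply_isometry hV]
    set y := ContinuousLinearMap.adjoint V x
    let τ : ℕ → ℂ := fun j => if j < n then 0 else s j
    have hτ : ∀ j, ‖τ j‖ ≤ s n := fun j => by
      by_cases hj : j < n
      · simp [τ, hj, hs.1 n]
      · simp only [τ, hj, if_false, Complex.norm_real, Real.norm_of_nonneg (hs.1 j)]
        exact hs.2.1 (not_lt.1 hj)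
    have : diagOp e (fun n => (s n : ℂ)) (y - P y) = diagOp e τ y :=
      HilbertBasis_ext_inner e fun j => by
        rw [inner_diagOp e (norm_ofReal_le hs), inner_sub_right, inner_diagOp e hπ,
          inner_diagOp e hτ]
        by_cases hj : j < n <;> simp [π, τ, hj]
    rw [this]
    exact (norm_diagOp_apply_le e hτ y).trans
      (mul_le_mul_of_nonneg_left (norm_adjoint_isometry_le hV x) (hs.1 n))

/-- An operator of rank at most `n` kills a nonzero vector in the span of the first `n + 1`
eigenvectors, and `X` stretches that vector by at least `s n`. -/
theorem IsSNumberSeq.le_of_approxWithin {X : H →L[ℂ] H} {s : ℕ → ℝ} (h : IsSNumberSeq X s) {n : ℕ}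
    {c : ℝ} (hc : ApproxWithin X n c) : s n ≤ c := by
  obtain ⟨hs, f, hf, hfs, -⟩ := h
  obtain ⟨F, hF, hXF⟩ := hc
  let T : (Fin (n + 1) → ℂ) →ₗ[ℂ] H := Fintype.linearCombination ℂ fun i : Fin (n + 1) => f i
  have hT : ∀ a, T a = ∑ i, a i • f i := fun a => Fintype.linearCombination_apply _ _ _
  have hf' : Orthonormal ℂ fun i : Fin (n + 1) => f i := hf.comp _ Fin.val_injective
  have hnorm : ∀ a : Fin (n + 1) → ℂ, ‖∑ i, a i • f i‖ ^ 2 = ∑ i, ‖a i‖ ^ 2 := fun a => by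
    have h1 := hf'.inner_sum a a Finset.univ
    rw [inner_self_eq_norm_sq_to_K] at h1
    have h2 : ((‖∑ i, a i • f i‖ ^ 2 : ℝ) : ℂ) = ((∑ i, ‖a i‖ ^ 2 : ℝ) : ℂ) := by
      push_cast
      refine h1.trans (Finset.sum_congr rfl fun i _ => ?_)
      exact Complex.conj_mul' _
    exact_mod_cast h2
  obtain ⟨a, ha0, ha⟩ : ∃ a, a ≠ 0 ∧ F (T a) = 0 := by
    by_contra! hne
    have hinj : Function.Injective ((F : H →ₗ[ℂ] H).comp T) := by
      rw [← LinearMap.ker_eq_bot, LinearMap.ker_eq_bot']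
      intro a ha
      by_contra h0
      exact hne a h0 ha
    have h1 := LinearMap.finrank_range_of_inj hinj
    have h2 := Module.finrank_le_of_rank_le
      ((LinearMap.rank_comp_le_left T (F : H →ₗ[ℂ] H)).trans hF)
    rw [h1, Module.finrank_fin_fun] at h2
    omega
  have hpos : 0 < ‖T a‖ := by
    rw [norm_pos_iff]
    intro h0
    have h1 := hnorm a
    rw [← hT, h0, norm_zero, zero_pow two_ne_zero, eq_comm,
      Finset.sum_eq_zero_iff_of_nonneg fun i _ => sq_nonneg _] at h1
    exact ha0 (funext fun i => by simpa using h1 i (Finset.mem_univ i))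
  have h1 : ‖X (T a)‖ ≤ c * ‖T a‖ := by simpa [ha] using hXF (T a)
  have h2 : s n * ‖T a‖ ≤ ‖X (T a)‖ := by
    rw [← norm_abs_apply]
    have h3 : CFC.abs X (T a) = ∑ i, (a i * (s i : ℂ)) • f i := by
      rw [hT, map_sum]
      exact Finset.sum_congr rfl fun i _ => by rw [map_smul, hfs, smul_smul]
    refine (sq_le_sq₀ (mul_nonneg (hs.1 n) (norm_nonneg _)) (norm_nonneg _)).1 ?_
    rw [h3, hT, mul_pow, hnorm, hnorm, Finset.mul_sum]
    refine Finset.sum_le_sum fun i _ => ?_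
    rw [norm_mul, mul_pow, mul_comm, Complex.norm_real, Real.norm_of_nonneg (hs.1 _)]
    exact mul_le_mul_of_nonneg_left
      (pow_le_pow_left₀ (hs.1 n) (hs.2.1 (by omega)) 2) (sq_nonneg _)
  exact le_of_mul_le_mul_right (h2.trans h1) hpos

theorem IsSNumberSeq.unique {X : H →L[ℂ] H} {s t : ℕ → ℝ} (hs : IsSNumberSeq X s)
    (ht : IsSNumberSeq X t) (e : HilbertBasis ℕ ℂ H) : s = t :=
  funext fun n => le_antisymm (hs.le_of_approxWithin (ht.approxWithin e n))
    (ht.le_of_approxWithin (hs.approxWithin e n))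

/-- Singular numbers of the elements of the ideal generated by diagonal operators. -/
theorem exists_bound_of_mem_idealOfCharSet {T S : Set (ℕ → ℝ)} (hT : T ⊆ c0Star) (hTS : T ⊆ S)
    (hS0 : (0 : ℕ → ℝ) ∈ S) (hpos : ∀ ζ ∈ S, ∀ n, 0 ≤ ζ n)
    (hadd : ∀ ζ ∈ S, ∀ ζ' ∈ S, ζ + ζ' ∈ S) (hsmul : ∀ c : ℝ, 0 ≤ c → ∀ ζ ∈ S, c • ζ ∈ S)
    (hamp : ∀ ζ ∈ S, ampliation ζ ∈ S) {X : H →L[ℂ] H} (hX : X ∈ idealOfCharSet e T)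
    {s : ℕ → ℝ} (hs : IsSNumberSeq X s) : ∃ ζ ∈ S, ∀ n, s n ≤ ζ n := by
  -- Approximability makes sense for every operator and so passes through the induction; a singular
  -- number sequence is needed only for the final `X`.
  suffices h : ∃ ζ ∈ S, ∀ n, ApproxWithin X n (ζ n) by
    obtain ⟨ζ, hζ, h⟩ := h
    exact ⟨ζ, hζ, fun n => hs.le_of_approxWithin (h n)⟩
  clear hs
  unfold idealOfCharSet at hX
  induction hX using TwoSidedIdeal.span_induction with
  | mem X h =>
    obtain ⟨ζ, hζ, rfl⟩ := h
    exact ⟨ζ, hTS hζ, (isSNumberSeq_diagOp e (hT hζ)).approxWithin e⟩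
  | zero => exact ⟨0, hS0, approxWithin_zero⟩
  | add X Y _ _ hX hY =>
    obtain ⟨ζ, hζ, hX⟩ := hX
    obtain ⟨ζ', hζ', hY⟩ := hY
    -- Ranks add, so each summand may use rank at most `n / 2`; this is the source of the
    -- ampliation.
    exact ⟨ampliation (ζ + ζ'), hamp _ (hadd _ hζ _ hζ'), fun n =>
      (hX (n / 2)).add (hY (n / 2)) (by omega)⟩
  | neg X _ hX =>
    obtain ⟨ζ, hζ, hX⟩ := hX
    refine ⟨ζ, hζ, fun n => ?_⟩
    obtain ⟨F, hF, h⟩ := hX n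
    refine ⟨-F, ?_, fun x => ?_⟩
    · have := LinearMap.rank_comp_le_right (F : H →ₗ[ℂ] H) (-LinearMap.id)
      exact le_trans (by simpa using this) hF
    · rw [neg_apply, neg_apply, ← neg_sub', norm_neg]
      exact h x
  | left_absorb A X _ hX =>
    obtain ⟨ζ, hζ, hX⟩ := hX
    exact ⟨‖A‖ • ζ, hsmul _ (norm_nonneg _) _ hζ, fun n => (hX n).mul_left A⟩
  | right_absorb A X _ hX =>
    obtain ⟨ζ, hζ, hX⟩ := hX
    exact ⟨‖A‖ • ζ, hsmul _ (norm_nonneg _) _ hζ, fun n => (hX n).mul_right (hpos _ hζ n) A⟩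

end Operators

/-! ### Matrices of isometries and characteristic sets of ideals -/

section Ideals

variable {H : Type*} [NormedAddCommGroup H] [InnerProductSpace ℂ H] (e : HilbertBasis ℕ ℂ H)

theorem hasSum_norm_inner_sq (x : H) : HasSum (fun n => ‖⟪e n, x⟫_ℂ‖ ^ 2) (‖x‖ ^ 2) := by
  have h := e.hasSum_inner_mul_inner x x
  have h1 : ∀ n, ⟪x, e n⟫_ℂ * ⟪e n, x⟫_ℂ = ((‖⟪e n, x⟫_ℂ‖ ^ 2 : ℝ) : ℂ) := fun n => by
    rw [← inner_conj_symm x (e n), Complex.conj_mul', Complex.ofReal_pow]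
  simp only [h1, inner_self_eq_norm_sq_to_K] at h
  refine Complex.hasSum_ofReal.1 ?_
  rw [Complex.ofReal_pow]
  exact h

theorem inner_diagOp_self {ρ : ℕ → ℝ} {C : ℝ} (hρ : ∀ n, ‖(ρ n : ℂ)‖ ≤ C) (y : H) :
    HasSum (fun j => ‖⟪e j, y⟫_ℂ‖ ^ 2 * ρ j) (⟪y, diagOp e (fun n => (ρ n : ℂ)) y⟫_ℂ).re ∧
      ((⟪y, diagOp e (fun n => (ρ n : ℂ)) y⟫_ℂ).re : ℂ) =
        ⟪y, diagOp e (fun n => (ρ n : ℂ)) y⟫_ℂ := by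
  have h := e.hasSum_inner_mul_inner y (diagOp e (fun n => (ρ n : ℂ)) y)
  have h1 : ∀ j, ⟪y, e j⟫_ℂ * ⟪e j, diagOp e (fun n => (ρ n : ℂ)) y⟫_ℂ =
      ((‖⟪e j, y⟫_ℂ‖ ^ 2 * ρ j : ℝ) : ℂ) := fun j => by
    rw [inner_diagOp e hρ, ← inner_conj_symm y (e j), mul_left_comm, Complex.conj_mul']
    push_cast
    ring
  simp only [h1] at h
  have h2 := Complex.hasSum_re h
  simp only [Complex.ofReal_re] at h2
  exact ⟨h2, ((Complex.hasSum_ofReal.2 h2).unique h)⟩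

/-! ### The matrix of an isometry -/

theorem matApply_le {P : Matrix ℕ ℕ ℝ} (hP : IsSubstochastic P) {ξ : ℕ → ℝ} (hξ : ξ ∈ l1Star)
    (i : ℕ) : matApply P ξ i ≤ ξ 0 := by
  have h1 : ∀ j, P i j * ξ j ≤ P i j * ξ 0 := fun j =>
    mul_le_mul_of_nonneg_left (hξ.2.1 (Nat.zero_le j)) (hP.1 i j)
  have h2 := (hP.2.1 i).1.mul_right (ξ 0)
  refine ((Summable.of_nonneg_of_le (fun j => mul_nonneg (hP.1 i j) (hξ.1 j)) h1 h2).tsum_le_tsum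
    h1 h2).trans ?_
  rw [tsum_mul_right]
  exact mul_le_of_le_one_left (hξ.1 0) (hP.2.1 i).2

theorem norm_ofReal_matApply_le {P : Matrix ℕ ℕ ℝ} (hP : IsSubstochastic P) {ξ : ℕ → ℝ}
    (hξ : ξ ∈ l1Star) (i : ℕ) : ‖(matApply P ξ i : ℂ)‖ ≤ ξ 0 := by
  rw [Complex.norm_real, Real.norm_of_nonneg (matApply_nonneg hP hξ i)]
  exact matApply_le hP hξ i

variable [CompleteSpace H]

/-- A block orthogonal matrix is the matrix of an isometry. -/
theorem IsBlockOrthogonal.exists_isometry {L : Matrix ℕ ℕ ℝ} (hL : IsBlockOrthogonal L) :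
    ∃ U : H →L[ℂ] H, Isometry U ∧ ∀ i j, ⟪e i, U (e j)⟫_ℂ = (L i j : ℂ) := by
  obtain ⟨m, h0, hm, hblock, horth⟩ := hL
  choose blk hblk using exists_block h0 hm
  have hL0 : ∀ i j, i ∉ Set.Ico (m (blk j)) (m (blk j + 1)) → L i j = 0 := by
    intro i j hi
    by_contra hne
    obtain ⟨k, hk1, hk2⟩ := hblock i j hne
    rw [block_unique hm hk2 (hblk j)] at hk1
    exact hi hk1
  let u : ℕ → H := fun j => ∑ i ∈ Finset.Ico (m (blk j)) (m (blk j + 1)), (L i j : ℂ) • e i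
  have hu : ∀ i j, ⟪e i, u j⟫_ℂ = (L i j : ℂ) := fun i j => by
    simp only [u, inner_sum, inner_smul_right, inner_basis, mul_ite, mul_one, mul_zero,
      Finset.sum_ite_eq]
    split_ifs with h
    · rfl
    · rw [hL0 i j (by simpa using h), Complex.ofReal_zero]
  -- Columns in one block are orthonormal by orthogonality of the block; columns in different blocks
  -- have disjoint supports.
  have horthn : Orthonormal ℂ u := by
    rw [orthonormal_iff_ite]
    intro i j
    have h1 : ⟪u i, u j⟫_ℂ =
        ((∑ l ∈ Finset.Ico (m (blk i)) (m (blk i + 1)), L l i * L l j : ℝ) : ℂ) := by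
      rw [show u i = ∑ l ∈ Finset.Ico (m (blk i)) (m (blk i + 1)), (L l i : ℂ) • e l from rfl,
        sum_inner]
      simp only [inner_smul_left, hu, Complex.conj_ofReal]
      push_cast
      rfl
    rw [h1]
    rcases eq_or_ne (blk i) (blk j) with hij | hij
    · obtain ⟨k, hk⟩ : ∃ k, blk i = k := ⟨_, rfl⟩
      have hi := hblk i
      have hj := hblk j
      rw [← hij] at hj
      rw [hk] at hi hj ⊢
      rw [sum_Ico_eq_sum_fin _ (hm k.lt_succ_self).le]
      have h2 := congrFun (congrFun (Matrix.mem_orthogonalGroup_iff' _ _ |>.1 (horth k))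
        ⟨i - m k, by have := hi.1; have := hi.2; omega⟩)
        ⟨j - m k, by have := hj.1; have := hj.2; omega⟩
      rw [Matrix.mul_apply] at h2
      change ∑ x : Fin (m (k + 1) - m k), L (m k + x) (m k + (i - m k)) *
        L (m k + x) (m k + (j - m k)) = _ at h2
      simp only [Matrix.one_apply, Nat.add_sub_cancel' hi.1, Nat.add_sub_cancel' hj.1,
        Fin.mk.injEq] at h2
      rw [h2]
      have h3 : i - m k = j - m k ↔ i = j := by have := hi.1; have := hj.1; omega
      simp only [h3]
      split_ifs <;> simp
    · rw [if_neg (fun h => hij (congrArg blk h)), Finset.sum_eq_zero, Complex.ofReal_zero]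
      intro l hl
      rw [hL0 l j, mul_zero]
      exact fun h => hij (block_unique hm (Finset.mem_Ico.1 hl) h)
  obtain ⟨U, hU, hUe⟩ := OperatorIdeal.exists_isometry e horthn
  exact ⟨U, hU, fun i j => by rw [hUe, hu]⟩

/-- By Parseval, column sums are `‖V e_j‖ ^ 2 = 1` and row sums are `‖V* e_i‖ ^ 2 ≤ 1`. -/
theorem isColumnStochastic_of_isometry {V : H →L[ℂ] H} (hV : Isometry V) :
    IsColumnStochastic fun i j => ‖⟪e i, V (e j)⟫_ℂ‖ ^ 2 := by
  have hcol : ∀ j, HasSum (fun i => ‖⟪e i, V (e j)⟫_ℂ‖ ^ 2) 1 := fun j => by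
    have := hasSum_norm_inner_sq e (V (e j))
    rwa [norm_isometry hV, e.orthonormal.1 j, one_pow] at this
  have hrow : ∀ i, HasSum (fun j => ‖⟪e i, V (e j)⟫_ℂ‖ ^ 2)
      (‖ContinuousLinearMap.adjoint V (e i)‖ ^ 2) := fun i => by
    have := hasSum_norm_inner_sq e (ContinuousLinearMap.adjoint V (e i))
    simpa only [ContinuousLinearMap.adjoint_inner_right, norm_inner_symm (V (e _))] using this
  refine ⟨⟨fun i j => sq_nonneg _, fun i => ⟨(hrow i).summable, ?_⟩, fun j =>
    ⟨(hcol j).summable, (hcol j).tsum_eq.le⟩⟩, fun j => (hcol j).tsum_eq⟩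
  rw [(hrow i).tsum_eq]
  refine pow_le_one₀ (norm_nonneg _) ?_
  simpa [e.orthonormal.1 i] using norm_adjoint_isometry_le hV (e i)

/-- The diagonal entry at `n` is the quadratic form of `diag ξ` at `V* e_n`, a sum of the `ξ j`
weighted by squared coordinates. -/
theorem expect_conj_diagOp (V : H →L[ℂ] H) {ξ : ℕ → ℝ} (hξ : ξ ∈ l1Star) :
    expect e (V ∘L diagOp e (fun n => (ξ n : ℂ)) ∘L ContinuousLinearMap.adjoint V) =
      diagOp e fun n => (matApply (fun i j => ‖⟪e i, V (e j)⟫_ℂ‖ ^ 2) ξ n : ℂ) := by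
  unfold expect
  congr 1
  ext n
  have h := inner_diagOp_self e (norm_ofReal_le (l1Star_subset_c0Star hξ))
    (ContinuousLinearMap.adjoint V (e n))
  rw [ContinuousLinearMap.comp_apply, ContinuousLinearMap.comp_apply,
    ← ContinuousLinearMap.adjoint_inner_left, ← h.2, ← h.1.tsum_eq]
  change _ = ((∑' j, ‖⟪e n, V (e j)⟫_ℂ‖ ^ 2 * ξ j : ℝ) : ℂ)
  simp only [ContinuousLinearMap.adjoint_inner_right, norm_inner_symm (V (e _))]

/-! ### Characteristic sets of ideals -/

/-- The diagonal operator of the singular numbers of `X` factors through `X`. -/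
theorem IsSNumberSeq.exists_factorization {X : H →L[ℂ] H} {s : ℕ → ℝ} (h : IsSNumberSeq X s) :
    ∃ A B : H →L[ℂ] H, A * (X * B) = diagOp e fun n => (s n : ℂ) := by
  obtain ⟨hs, f, hf, hfs, -⟩ := h
  have hb := norm_ofReal_le hs
  obtain ⟨V, hV, hVf⟩ := OperatorIdeal.exists_isometry e hf
  have hX : ∀ n m, ⟪X (f n), X (f m)⟫_ℂ = if n = m then (s n : ℂ) ^ 2 else 0 := fun n m => by
    rw [← inner_abs_abs, hfs, hfs, inner_smul_left, inner_smul_right, orthonormal_iff_ite.1 hf]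
    split_ifs with h <;> simp [h, sq]
  -- The normalized images of the eigenvectors are orthonormal where `s n ≠ 0`, so `A` only has to
  -- send them back to the basis.
  have hg : ∀ n m, s n ≠ 0 → ⟪((s n : ℂ)⁻¹) • X (f n), X (f m)⟫_ℂ =
      if n = m then (s n : ℂ) else 0 := fun n m hn => by
    have : (s n : ℂ) ≠ 0 := by exact_mod_cast hn
    rw [inner_smul_left, hX]
    split_ifs with h
    · simp only [map_inv₀, Complex.conj_ofReal]
      field_simp
    · simp
  suffices h : ∃ A : H →L[ℂ] H, ∀ n m, ⟪e n, A (X (f m))⟫_ℂ = if n = m then (s n : ℂ) else 0 by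
    obtain ⟨A, hA⟩ := h
    refine ⟨A, V, HilbertBasis_ext_clm e fun m => HilbertBasis_ext_inner e fun n => ?_⟩
    rw [mul_apply_eq_comp, mul_apply_eq_comp, hVf, hA, diagOp_basis e hb, inner_smul_right,
      inner_basis]
    split_ifs with h <;> simp [h]
  by_cases h0 : ∀ n, s n ≠ 0
  · have ho : Orthonormal ℂ fun n => ((s n : ℂ)⁻¹) • X (f n) := by
      rw [orthonormal_iff_ite]
      intro i j
      rw [inner_smul_right, hg i j (h0 i)]
      have : (s i : ℂ) ≠ 0 := by exact_mod_cast h0 i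
      split_ifs with h
      · rw [← h, inv_mul_cancel₀ this]
      · rw [mul_zero]
    obtain ⟨W, -, hWe⟩ := OperatorIdeal.exists_isometry e ho
    exact ⟨ContinuousLinearMap.adjoint W, fun n m => by
      rw [ContinuousLinearMap.adjoint_inner_right, hWe, hg n m (h0 n)]⟩
  -- One zero singular number forces all later ones to vanish, so a finite sum of rank-one operators
  -- serves as `A`.
  · push Not at h0
    obtain ⟨N, hN⟩ := h0
    have hN' : ∀ n, s n ≠ 0 → n < N := fun n hn => by
      by_contra hlt
      exact hn (le_antisymm (hN ▸ hs.2.1 (not_lt.1 hlt)) (hs.1 n))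
    classical
    refine ⟨∑ j ∈ (Finset.range N).filter fun j => s j ≠ 0,
      (innerSL ℂ ((s j : ℂ)⁻¹ • X (f j))).smulRight (e j), fun n m => ?_⟩
    simp only [sum_apply, ContinuousLinearMap.smulRight_apply,
      innerSL_apply_apply, inner_sum, inner_smul_right, inner_basis, mul_ite, mul_one, mul_zero,
      Finset.sum_ite_eq, Finset.mem_filter, Finset.mem_range]
    by_cases hn : s n = 0
    · simp [hn]
    · rw [if_pos ⟨hN' n hn, hn⟩, hg n m hn]

variable {I : TwoSidedIdeal (H →L[ℂ] H)}

theorem charSet_subset_c0Star {J : Set (H →L[ℂ] H)} : charSet J ⊆ c0Star :=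
  fun _ ⟨_, _, h⟩ => h.1

theorem mem_charSet_of_diagOp_mem {J : Set (H →L[ℂ] H)} {η : ℕ → ℝ} (hη : η ∈ c0Star)
    (h : (diagOp e fun n => (η n : ℂ)) ∈ J) : η ∈ charSet J :=
  ⟨_, h, isSNumberSeq_diagOp e hη⟩

theorem diagOp_mem_of_mem_charSet {η : ℕ → ℝ} (h : η ∈ charSet (I : Set (H →L[ℂ] H))) :
    (diagOp e fun n => (η n : ℂ)) ∈ I := by
  obtain ⟨X, hX, hs⟩ := h
  obtain ⟨A, B, hAB⟩ := hs.exists_factorization e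
  rw [← hAB]
  exact I.mul_mem_left _ _ (I.mul_mem_right _ _ hX)

theorem mem_charSet_iff {η : ℕ → ℝ} (hη : η ∈ c0Star) :
    η ∈ charSet (I : Set (H →L[ℂ] H)) ↔ (diagOp e fun n => (η n : ℂ)) ∈ I :=
  ⟨diagOp_mem_of_mem_charSet e, mem_charSet_of_diagOp_mem e hη⟩

/-- Characteristic sets of ideals are hereditary up to constants. -/
theorem mem_charSet_of_le (e : HilbertBasis ℕ ℂ H) {η ζ : ℕ → ℝ}
    (h : η ∈ charSet (I : Set (H →L[ℂ] H))) (hζ : ζ ∈ c0Star) {C : ℝ} (hle : ∀ n, ζ n ≤ C * η n) :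
    ζ ∈ charSet (I : Set (H →L[ℂ] H)) := by
  have hη := charSet_subset_c0Star h
  rw [mem_charSet_iff e hζ]
  -- Where `η n = 0` also `ζ n = 0`, so the convention that division by zero gives zero is harmless.
  have hq : ∀ n, ‖((ζ n / η n : ℝ) : ℂ)‖ ≤ |C| := fun n => by
    rw [Complex.norm_real, Real.norm_of_nonneg (div_nonneg (hζ.1 n) (hη.1 n))]
    exact div_le_of_le_mul₀ (hη.1 n) (abs_nonneg C)
      ((hle n).trans (mul_le_mul_of_nonneg_right (le_abs_self C) (hη.1 n)))
  have : (diagOp e fun n => (ζ n : ℂ)) =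
      diagOp e (fun n => ((ζ n / η n : ℝ) : ℂ)) * diagOp e fun n => (η n : ℂ) := by
    rw [diagOp_mul e hq (norm_ofReal_le hη)]
    congr 1
    ext n
    rw [Pi.mul_apply, ← Complex.ofReal_mul]
    rcases eq_or_ne (η n) 0 with h0 | h0
    · have h1 := hle n
      rw [h0, mul_zero] at h1
      rw [le_antisymm h1 (hζ.1 n), zero_div, zero_mul]
    · rw [div_mul_cancel₀ _ h0]
  rw [this]
  exact I.mul_mem_left _ _ (diagOp_mem_of_mem_charSet e h)

theorem smul_mem_charSet (e : HilbertBasis ℕ ℂ H) {η : ℕ → ℝ}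
    (h : η ∈ charSet (I : Set (H →L[ℂ] H))) {c : ℝ} (hc : 0 ≤ c) :
    c • η ∈ charSet (I : Set (H →L[ℂ] H)) :=
  mem_charSet_of_le e h (smul_mem_c0Star (charSet_subset_c0Star h) hc) fun _ => le_rfl

theorem add_mem_charSet (e : HilbertBasis ℕ ℂ H) {η ζ : ℕ → ℝ}
    (h : η ∈ charSet (I : Set (H →L[ℂ] H))) (h' : ζ ∈ charSet (I : Set (H →L[ℂ] H))) :
    η + ζ ∈ charSet (I : Set (H →L[ℂ] H)) := by
  have hη := charSet_subset_c0Star h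
  have hζ := charSet_subset_c0Star h'
  rw [mem_charSet_iff e (add_mem_c0Star hη hζ)]
  have := I.add_mem (diagOp_mem_of_mem_charSet e h) (diagOp_mem_of_mem_charSet e h')
  rw [diagOp_add e (norm_ofReal_le hη) (norm_ofReal_le hζ)] at this
  convert this using 2
  ext n
  simp

/-- Two isometries onto the spans of the even and of the odd basis vectors carry copies of `diag η`,
and their sum is the ampliated diagonal. -/
theorem ampliation_mem_charSet (e : HilbertBasis ℕ ℂ H) {η : ℕ → ℝ}
    (h : η ∈ charSet (I : Set (H →L[ℂ] H))) :
    ampliation η ∈ charSet (I : Set (H →L[ℂ] H)) := by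
  have hη := charSet_subset_c0Star h
  rw [mem_charSet_iff e (ampliation_mem_c0Star hη)]
  have hD := diagOp_mem_of_mem_charSet e h
  obtain ⟨V, hV, hVe⟩ := exists_isometry e (e.orthonormal.comp (fun n => 2 * n)
    fun a b hab => by simpa using hab)
  obtain ⟨W, hW, hWe⟩ := exists_isometry e (e.orthonormal.comp (fun n => 2 * n + 1)
    fun a b hab => by simpa using hab)
  simp only [Function.comp_apply] at hVe hWe
  have hV' : ∀ n, ContinuousLinearMap.adjoint V (e (2 * n)) = e n := fun n => by
    rw [← hVe, adjoint_apply_isometry hV]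
  have hW' : ∀ n, ContinuousLinearMap.adjoint W (e (2 * n + 1)) = e n := fun n => by
    rw [← hWe, adjoint_apply_isometry hW]
  have hV0 : ∀ n, ContinuousLinearMap.adjoint V (e (2 * n + 1)) = 0 := fun n =>
    HilbertBasis_ext_inner e fun m => by
      rw [ContinuousLinearMap.adjoint_inner_right, hVe, inner_basis, if_neg (by omega),
        inner_zero_right]
  have hW0 : ∀ n, ContinuousLinearMap.adjoint W (e (2 * n)) = 0 := fun n =>
    HilbertBasis_ext_inner e fun m => by
      rw [ContinuousLinearMap.adjoint_inner_right, hWe, inner_basis, if_neg (by omega),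
        inner_zero_right]
  have hb := norm_ofReal_le hη
  have : (diagOp e fun n => (ampliation η n : ℂ)) =
      V * ((diagOp e fun n => (η n : ℂ)) * ContinuousLinearMap.adjoint V) +
      W * ((diagOp e fun n => (η n : ℂ)) * ContinuousLinearMap.adjoint W) := by
    refine HilbertBasis_ext_clm e fun n => ?_
    rw [diagOp_basis e (norm_ofReal_le (ampliation_mem_c0Star hη))]
    simp only [add_apply, mul_apply_eq_comp]
    obtain ⟨k, rfl | rfl⟩ := n.even_or_odd'
    · rw [hV', hW0, diagOp_basis e hb, map_smul, hVe, map_zero, map_zero, add_zero, ampliation,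
        Nat.mul_div_cancel_left k two_pos]
    · rw [hV0, hW', diagOp_basis e hb, map_smul, hWe, map_zero, map_zero, zero_add, ampliation,
        show (2 * k + 1) / 2 = k by omega]
  rw [this]
  exact I.add_mem (I.mul_mem_left _ _ (I.mul_mem_right _ _ hD))
    (I.mul_mem_left _ _ (I.mul_mem_right _ _ hD))

theorem zero_mem_charSet (e : HilbertBasis ℕ ℂ H) :
    (0 : ℕ → ℝ) ∈ charSet (I : Set (H →L[ℂ] H)) := by
  refine ⟨0, I.zero_mem, ⟨fun _ => le_rfl, fun _ _ _ => le_rfl, tendsto_const_nhds⟩, e,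
    e.orthonormal, fun n => ?_, fun x _ => ?_⟩ <;> simp

/-- Trace class membership provides some summable singular sequence; uniqueness identifies it with
the given one. -/
theorem charSet_subset_l1Star (e : HilbertBasis ℕ ℂ H)
    (hI : (I : Set (H →L[ℂ] H)) ⊆ traceClass H) : charSet (I : Set (H →L[ℂ] H)) ⊆ l1Star := by
  rintro η ⟨X, hX, hη⟩
  obtain ⟨s, hs, hsum⟩ := hI hX
  rw [hη.unique hs e]
  exact ⟨hs.1.1, hs.1.2.1, hsum⟩

theorem exists_mem_charSet_pos (e : HilbertBasis ℕ ℂ H) (hI0 : I ≠ ⊥)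
    (hI : (I : Set (H →L[ℂ] H)) ⊆ traceClass H) :
    ∃ η ∈ charSet (I : Set (H →L[ℂ] H)), 0 < η 0 := by
  obtain ⟨X, hX, hX0⟩ : ∃ X ∈ I, X ≠ 0 := by
    by_contra! h
    exact hI0 (le_bot_iff.1 fun X hX => (TwoSidedIdeal.mem_bot _).2 (h X hX))
  obtain ⟨s, hs, -⟩ := hI hX
  refine ⟨s, ⟨X, hX, hs⟩, lt_of_le_of_ne (hs.1.1 0) fun h0 => hX0 ?_⟩
  obtain ⟨V, -, hV⟩ := hs.exists_isometry e
  ext x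
  rw [zero_apply, ← norm_eq_zero, ← norm_abs_apply, hV]
  have h1 := norm_diagOp_apply_le e (norm_ofReal_le hs.1) (ContinuousLinearMap.adjoint V x)
  rw [← h0, zero_mul] at h1
  rw [norm_le_zero_iff.1 h1, map_zero, norm_zero]

/-- If `diag(Pξ)` belongs to an ideal of trace class operators, with `P` column-stochastic, then
its sequence of singular numbers majorizes `ξ` at infinity. -/
theorem exists_majorizedAtInfty_of_diagOp_mem (hI : (I : Set (H →L[ℂ] H)) ⊆ traceClass H)
    {P : Matrix ℕ ℕ ℝ} (hP : IsColumnStochastic P) {ξ : ℕ → ℝ} (hξ : ξ ∈ l1Star)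
    (h : (diagOp e fun n => (matApply P ξ n : ℂ)) ∈ I) :
    ∃ η ∈ charSet (I : Set (H →L[ℂ] H)), MajorizedAtInfty ξ η := by
  obtain ⟨s, hs, -⟩ := hI h
  refine ⟨s, ⟨_, h, hs⟩, ?_⟩
  obtain ⟨V, hV, habs⟩ := hs.exists_isometry e
  have hb := norm_ofReal_matApply_le hP.1 hξ
  rw [CFC.abs_of_nonneg _ (diagOp_isPositive e (matApply_nonneg hP.1 hξ) hb)] at habs
  have hR := isColumnStochastic_of_isometry e hV
  -- As `diag(Pξ)` is positive, `s` is the diagonal of `V* diag(Pξ) V`. Thus `R` is the transpose of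
  -- the stochastic matrix of `V`, with row sums 1 and column sums at most 1.
  refine majorizedAtInfty_of_columnStochastic hP
    (R := fun i j => ENNReal.ofReal (‖⟪e j, V (e i)⟫_ℂ‖ ^ 2))
    (fun i => (tsum_ofReal_column hR i).le) (fun j => tsum_ofReal_row_le hR.1 j) hξ hs.1.1
    hs.1.2.1 (fun i => ?_) (fun j hj => ?_)
  · have h1 := (inner_diagOp_self e hb (V (e i))).1
    have h2 : diagOp e (fun n => (matApply P ξ n : ℂ)) (V (e i)) = (s i : ℂ) • V (e i) := by
      rw [habs, adjoint_apply_isometry hV, diagOp_basis e (norm_ofReal_le hs.1), map_smul]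
    have h3 : ⟪V (e i), (s i : ℂ) • V (e i)⟫_ℂ = (s i : ℂ) := by
      rw [inner_smul_right, isometry_inner hV, inner_basis, if_pos rfl, mul_one]
    rw [h2, h3, Complex.ofReal_re] at h1
    rw [← h1.tsum_eq, ENNReal.ofReal_tsum_of_nonneg
      (fun j => mul_nonneg (sq_nonneg _) (matApply_nonneg hP.1 hξ j)) h1.summable]
    exact tsum_congr fun j => ENNReal.ofReal_mul (sq_nonneg _)
  · have hj' : (matApply P ξ j : ℂ) ≠ 0 := by exact_mod_cast hj
    -- A basis vector with nonzero eigenvalue lies in the range of `V`, so its column of `R` has sum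
    -- exactly 1 and no mass is lost.
    obtain ⟨z, hz⟩ : ∃ z, V z = e j := by
      refine ⟨(matApply P ξ j : ℂ)⁻¹ • diagOp e (fun n => (s n : ℂ))
        (ContinuousLinearMap.adjoint V (e j)), ?_⟩
      rw [map_smul, ← habs, diagOp_basis e hb, smul_smul, inv_mul_cancel₀ hj', one_smul]
    have h1 := hasSum_norm_inner_sq e z
    rw [← norm_isometry hV z, hz, e.orthonormal.1 j, one_pow] at h1
    rw [← ENNReal.ofReal_one, ← h1.tsum_eq,
      ENNReal.ofReal_tsum_of_nonneg (fun _ => sq_nonneg _) h1.summable]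
    exact tsum_congr fun i => by rw [← hz, isometry_inner hV, norm_inner_symm]

/-! ### The am-∞ closure -/

/-- The sequences bounded by some `amInfty η` form a family stable under sums, scaling and
ampliation, and the constant `M` is absorbed into `η`. -/
theorem exists_amInfty_bound (hI : (I : Set (H →L[ℂ] H)) ⊆ traceClass H) {ζ : ℕ → ℝ}
    (hζ : ζ ∈ charSet (amInftyIdeal e I : Set (H →L[ℂ] H))) :
    ∃ η ∈ charSet (I : Set (H →L[ℂ] H)), ∀ n, ζ n ≤ amInfty η n := by
  obtain ⟨X, hX, hs⟩ := hζ
  have hl := charSet_subset_l1Star e hI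
  suffices h : ∃ ζ' ∈ {ζ : ℕ → ℝ | (∀ n, 0 ≤ ζ n) ∧ ∃ η ∈ charSet (I : Set (H →L[ℂ] H)),
      ∀ n, ζ n ≤ amInfty η n}, ∀ n, ζ n ≤ ζ' n by
    obtain ⟨ζ', ⟨-, η, hη, hle⟩, h⟩ := h
    exact ⟨η, hη, fun n => (h n).trans (hle n)⟩
  refine exists_bound_of_mem_idealOfCharSet e
    (fun ζ hζ => hζ.1) ?_ ?_ (fun ζ hζ => hζ.1) ?_ ?_ ?_ hX hs
  · rintro ζ ⟨hζ, η, ⟨Y, hY, hYη⟩, M, hM, hle⟩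
    refine ⟨hζ.1, M • η, smul_mem_charSet e ⟨Y, hY.1, hYη⟩ hM.le, fun n => ?_⟩
    rw [amInfty_smul]
    exact hle n
  · exact ⟨fun _ => le_rfl, 0, zero_mem_charSet e, fun n => by simp [amInfty]⟩
  · rintro ζ ⟨h0, η, hη, hle⟩ ζ' ⟨h0', η', hη', hle'⟩
    refine ⟨fun n => add_nonneg (h0 n) (h0' n), η + η', add_mem_charSet e hη hη', fun n => ?_⟩
    rw [amInfty_add (hl hη).2.2 (hl hη').2.2]
    exact add_le_add (hle n) (hle' n)
  · rintro c hc ζ ⟨h0, η, hη, hle⟩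
    refine ⟨fun n => mul_nonneg hc (h0 n), c • η, smul_mem_charSet e hη hc, fun n => ?_⟩
    rw [amInfty_smul]
    exact mul_le_mul_of_nonneg_left (hle n) hc
  · rintro ζ ⟨h0, η, hη, hle⟩
    exact ⟨fun n => h0 _, ampliation η, ampliation_mem_charSet e hη, fun n =>
      (hle _).trans (ampliation_amInfty_le (hl hη) n)⟩

/-- Sequences majorized at infinity by elements of the characteristic set are stable under the same
operations, so they bound everything in the closure. Conversely, such a `ξ` and its mean at infinity
give generators of the two ideals directly. -/
theorem mem_charSet_amInftyClosure_iff (hI0 : I ≠ ⊥) (hI : (I : Set (H →L[ℂ] H)) ⊆ traceClass H)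
    {ξ : ℕ → ℝ} (hξ : ξ ∈ l1Star) :
    ξ ∈ charSet (amInftyClosure e I : Set (H →L[ℂ] H)) ↔
      ∃ η ∈ charSet (I : Set (H →L[ℂ] H)), MajorizedAtInfty ξ η := by
  have hl := charSet_subset_l1Star e hI
  constructor
  · rintro ⟨X, hX, hs⟩
    suffices h : ∃ ζ ∈ {ζ | ∃ η ∈ charSet (I : Set (H →L[ℂ] H)), MajorizedAtInfty ζ η},
        ∀ n, ξ n ≤ ζ n by
      obtain ⟨ζ, ⟨η, hη, hle⟩, h⟩ := h
      exact ⟨η, hη, hle.of_le (l1Star_subset_c0Star hξ) h⟩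
    refine exists_bound_of_mem_idealOfCharSet e
      (fun ζ hζ => l1Star_subset_c0Star hζ.1) ?_ ?_ ?_ ?_ ?_ ?_ hX hs
    · rintro ζ ⟨hζ, hζ'⟩
      obtain ⟨η, hη, hle⟩ := exists_amInfty_bound e hI hζ'
      -- `η` may be zero although `ζ 0 > 0`; adding `η₀` makes the total positive. This is where `I
      -- ≠ ⊥` enters.
      obtain ⟨η₀, hη₀, hpos⟩ := exists_mem_charSet_pos e hI0 hI
      have hsum := add_mem_charSet e hη hη₀
      obtain ⟨c, hc, h⟩ := majorizedAtInfty_of_amInfty_le hζ (hl hsum)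
        (add_pos_of_nonneg_of_pos ((hl hη).1 0) hpos) fun n => by
          rw [amInfty_add (hl hη).2.2 (hl hη₀).2.2]
          exact (hle n).trans (le_add_of_nonneg_right ((amInfty_mem_c0Star (hl hη₀)).1 n))
      exact ⟨_, smul_mem_charSet e hsum hc, h⟩
    · have h0 := zero_mem_charSet (I := I) e
      exact ⟨0, h0, hl h0, hl h0, fun _ => le_rfl⟩
    · rintro ζ ⟨η, hη, h⟩
      exact h.1.1
    · rintro ζ ⟨η, hη, h⟩ ζ' ⟨η', hη', h'⟩
      exact ⟨_, add_mem_charSet e hη hη', h.add h'⟩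
    · rintro c hc ζ ⟨η, hη, h⟩
      exact ⟨_, smul_mem_charSet e hη hc, h.smul hc⟩
    · rintro ζ ⟨η, hη, h⟩
      exact ⟨_, ampliation_mem_charSet e hη, h.ampliation⟩
  · rintro ⟨η, hη, h⟩
    refine mem_charSet_of_diagOp_mem e (l1Star_subset_c0Star hξ) ?_
    refine TwoSidedIdeal.subset_span ⟨ξ, ⟨hξ, ?_⟩, rfl⟩
    refine mem_charSet_of_diagOp_mem e (amInfty_mem_c0Star hξ) ?_
    refine TwoSidedIdeal.subset_span ⟨_, ⟨amInfty_mem_c0Star hξ, η, ?_, 1, one_pos, fun n => ?_⟩,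
      rfl⟩
    · obtain ⟨X, hX, hη⟩ := hη
      exact ⟨X, ⟨hX, hI hX⟩, hη⟩
    · rw [one_mul]
      exact amInfty_le_of_majorizedAtInfty h n

end Ideals

end OperatorIdeal

theorem theorem8p3 {H : Type*} [NormedAddCommGroup H] [InnerProductSpace ℂ H] [CompleteSpace H]
    (e : HilbertBasis ℕ ℂ H) (I : TwoSidedIdeal (H →L[ℂ] H)) (hI0 : I ≠ ⊥)
    (hI : (I : Set (H →L[ℂ] H)) ⊆ OperatorIdeal.traceClass H)
    (ξ : ℕ → ℝ) (hξ : ξ ∈ OperatorIdeal.l1Star) :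
    List.TFAE [
      ξ ∈ OperatorIdeal.charSet (OperatorIdeal.amInftyClosure e I : Set (H →L[ℂ] H)),
      ∃ η ∈ OperatorIdeal.charSet (I : Set (H →L[ℂ] H)), OperatorIdeal.MajorizedAtInfty ξ η,
      ∃ η ∈ OperatorIdeal.charSet (I : Set (H →L[ℂ] H)),
        OperatorIdeal.StronglyMajorizedAtInfty ξ η,
      ∃ η ∈ OperatorIdeal.charSet (I : Set (H →L[ℂ] H)), OperatorIdeal.StronglyMajorized η ξ,
      ∃ P : Matrix ℕ ℕ ℝ, OperatorIdeal.IsColumnStochastic P ∧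
        OperatorIdeal.matApply P ξ ∈ OperatorIdeal.charSet (I : Set (H →L[ℂ] H)),
      ∃ Q : Matrix ℕ ℕ ℝ, OperatorIdeal.IsBlockOrthostochastic Q ∧
        OperatorIdeal.matApply Q ξ ∈ OperatorIdeal.charSet (I : Set (H →L[ℂ] H)),
      ∃ V : H →L[ℂ] H, Isometry V ∧
        OperatorIdeal.expect e
          (V ∘L OperatorIdeal.diagOp e (fun n => (ξ n : ℂ)) ∘L ContinuousLinearMap.adjoint V) ∈ I,
      ∃ U : H →L[ℂ] H,
        (∃ L : Matrix ℕ ℕ ℝ, OperatorIdeal.IsBlockOrthogonal L ∧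
          ∀ i j, ⟪e i, U (e j)⟫_ℂ = (L i j : ℂ)) ∧
        OperatorIdeal.expect e
          (U ∘L OperatorIdeal.diagOp e (fun n => (ξ n : ℂ)) ∘L ContinuousLinearMap.adjoint U) ∈ I
    ] := by
  have hchar : ∀ {η : ℕ → ℝ}, η ∈ OperatorIdeal.charSet (I : Set (H →L[ℂ] H)) →
      η ∈ OperatorIdeal.l1Star := fun h => OperatorIdeal.charSet_subset_l1Star e hI h
  have hsqueeze : ∀ {η : ℕ → ℝ}, η ∈ OperatorIdeal.charSet (I : Set (H →L[ℂ] H)) →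
      OperatorIdeal.MajorizedAtInfty ξ η →
      ∃ ζ ∈ OperatorIdeal.charSet (I : Set (H →L[ℂ] H)), OperatorIdeal.Majorized ζ ξ ∧
        ∃ m : ℕ → ℕ, m 0 = 0 ∧ StrictMono m ∧
          ∀ k, ∑ j ∈ Finset.range (m k), ζ j = ∑ j ∈ Finset.range (m k), ξ j := by
    intro η hη h
    obtain ⟨ζ, hζ, hle, hrest⟩ := OperatorIdeal.exists_block_majorized h
    exact ⟨ζ, OperatorIdeal.mem_charSet_of_le e hη (OperatorIdeal.l1Star_subset_c0Star hζ) hle,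
      hrest⟩
  tfae_have 1 ↔ 2 := OperatorIdeal.mem_charSet_amInftyClosure_iff e hI0 hI hξ
  tfae_have 2 → 3 := by
    rintro ⟨η, hη, h⟩
    obtain ⟨ζ, hζ, hmaj, m, -, hm, he⟩ := hsqueeze hη h
    have hs := OperatorIdeal.tsum_eq_of_frequently hξ.2.2 (hchar hζ).2.2 hm he
    exact ⟨ζ, hζ, OperatorIdeal.majorizedAtInfty_of_majorized hξ (hchar hζ) hmaj hs.symm, hs.symm⟩
  tfae_have 3 → 2 := fun ⟨η, hη, h⟩ => ⟨η, hη, h.1⟩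
  tfae_have 2 → 4 := by
    rintro ⟨η, hη, h⟩
    obtain ⟨ζ, hζ, hmaj, m, -, hm, he⟩ := hsqueeze hη h
    exact ⟨ζ, hζ, OperatorIdeal.stronglyMajorized_of_frequently hmaj hm he⟩
  tfae_have 4 → 2 := fun ⟨η, hη, h⟩ =>
    ⟨η, hη, OperatorIdeal.majorizedAtInfty_of_stronglyMajorized hξ (hchar hη) h⟩
  tfae_have 2 → 6 := by
    rintro ⟨η, hη, h⟩
    obtain ⟨ζ, hζ, hmaj, m, h0, hm, he⟩ := hsqueeze hη h
    obtain ⟨Q, hQ, hQξ⟩ :=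
      OperatorIdeal.exists_blockOrthostochastic (hchar hζ).2.1 hξ.2.1 hmaj h0 hm he
    exact ⟨Q, hQ, by rwa [hQξ]⟩
  tfae_have 6 → 5 := by
    rintro ⟨Q, ⟨L, hL, hQ⟩, h⟩
    obtain ⟨U, hU, hUL⟩ := hL.exists_isometry e
    have hQU : Q = fun i j => ‖⟪e i, U (e j)⟫_ℂ‖ ^ 2 := by
      ext i j
      rw [hQ, hUL, Complex.norm_real, Real.norm_eq_abs, sq_abs]
    exact ⟨Q, hQU ▸ OperatorIdeal.isColumnStochastic_of_isometry e hU, h⟩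
  tfae_have 5 → 2 := fun ⟨P, hP, h⟩ =>
    OperatorIdeal.exists_majorizedAtInfty_of_diagOp_mem e hI hP hξ
      (OperatorIdeal.diagOp_mem_of_mem_charSet e h)
  tfae_have 6 → 8 := by
    rintro ⟨Q, ⟨L, hL, hQ⟩, h⟩
    obtain ⟨U, hU, hUL⟩ := hL.exists_isometry e
    have hQU : Q = fun i j => ‖⟪e i, U (e j)⟫_ℂ‖ ^ 2 := by
      ext i j
      rw [hQ, hUL, Complex.norm_real, Real.norm_eq_abs, sq_abs]
    refine ⟨U, ⟨L, hL, hUL⟩, ?_⟩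
    rw [OperatorIdeal.expect_conj_diagOp e U hξ, ← hQU]
    exact OperatorIdeal.diagOp_mem_of_mem_charSet e h
  tfae_have 8 → 7 := by
    rintro ⟨U, ⟨L, hL, hUL⟩, h⟩
    obtain ⟨V, hV, hVL⟩ := hL.exists_isometry e
    -- A bounded operator is determined by its matrix, so `U` is the isometry built from `L`.
    have hUV : U = V := OperatorIdeal.HilbertBasis_ext_clm e fun j =>
      OperatorIdeal.HilbertBasis_ext_inner e fun i => by rw [hUL, hVL]
    exact ⟨U, hUV ▸ hV, h⟩
  tfae_have 7 → 2 := by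
    rintro ⟨V, hV, h⟩
    rw [OperatorIdeal.expect_conj_diagOp e V hξ] at h
    exact OperatorIdeal.exists_majorizedAtInfty_of_diagOp_mem e hI
      (OperatorIdeal.isColumnStochastic_of_isometry e hV) hξ h
  tfae_finish
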